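/- A function $L$ is slowly varying if $\lim_{x\to\infty} L(tx)/L(x)=1$ for every $t>0$, and a real random variable $X$ (or its distribution) is regularly varying with index $\alpha>0$ if $\mathbb P(|X|>x)=x^{-\alpha}L(x)$ for all $x>0$, with $L$ slowly varying. **Theorem.** Let $\alpha\in(2,4)$. There are a constant $c_\alpha\in\mathbb R$ and a non-degenerate $\alpha/4$-stable random variable $\zeta_{\alpha/4}$, both depending only on $\alpha$ (the latter in law), with characteristic function $$\mathbb E\big[e^{\mathrm i t\zeta_{\alpha/4}}\big]=\exp\Big(\mathrm i t c_\alpha+\frac{\alpha}{4}\int_0^\infty\Big(e^{\mathrm i tx}-1-\frac{\mathrm i tx}{1+x^2}\Big)x^{-(\alpha/4+1)}\,dx\Big),\qquad t\in\mathbb R,$$ where the integral converges absolutely, such that the following holds. Let $X$ be a real random variable with $\mathbb E[X]=0$ and $\mathbb E[X^2]=1$ that is regularly varying with index $\alpha$, and put $a_k:=\inf\{x\in\mathbb R:\mathbb P(|X|>x)\le 1/k\}$. Let $p=p_n$ be a sequence of integers with $p_n\to\infty$ as $n\to\infty$. For each $n$ let $\mathbf x_1,\dots,\mathbf x_n$ be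 random vectors in $\mathbb R^{p}$ (for different $n$ they may live on different probability spaces) whose $np$ components are independent and distributed as $X$, and let $\mathbf S=\frac1n\sum_{t=1}^n\mathbf x_t\mathbf x_t^\top$ be the $p\times p$ sample covariance matrix. Then, as $n\to\infty$, $$\frac{n^2}{a_{np}^4}\operatorname{tr}(\mathbf S^2)-\frac{2n(n+p-2)}{a_{np}^4}\operatorname{tr}(\mathbf S)+\frac{np(n+p-2)}{a_{np}^4}\ \stackrel{d}{\longrightarrow}\ \zeta_{\alpha/4}.$$ -/

import Mathlib

open MeasureTheory ProbabilityTheory Filter Topology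

/-- `L` is slowly varying (at infinity): `L (t x) / L x → 1` as `x → ∞`, for every `t > 0`. -/
def SlowlyVarying (L : ℝ → ℝ) : Prop :=
  ∀ t : ℝ, 0 < t → Tendsto (fun x : ℝ => L (t * x) / L x) atTop (𝓝 1)

/-- A probability law `F` on `ℝ`, the law of `X`, is regularly varying with index `α`:
`P(|X| > x) = x ^ (-α) * L x` for all `x > 0`, with `L` slowly varying. -/
def RegularlyVaryingLaw (F : Measure ℝ) (α : ℝ) : Prop :=
  ∃ L : ℝ → ℝ, SlowlyVarying L ∧ ∀ x : ℝ, 0 < x → F.real {y : ℝ | x < |y|} = x ^ (-α) * L x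

/-- `a_k = inf {x ∈ ℝ : P(|X| > x) ≤ 1 / k}`, where `X` has law `F`. -/
noncomputable def tailQuantile (F : Measure ℝ) (k : ℕ) : ℝ :=
  sInf {x : ℝ | F.real {y : ℝ | x < |y|} ≤ 1 / (k : ℝ)}

/-- The sample covariance matrix `n⁻¹ ∑ₜ xₜ xₜᵀ`, of size `p × p`, of the data `xₜ = (x i t)ᵢ`,
`t = 1, …, n`. -/
noncomputable def sampleCov {p n : ℕ} (x : Fin p → Fin n → ℝ) : Matrix (Fin p) (Fin p) ℝ :=
  (n : ℝ)⁻¹ • ∑ t : Fin n, Matrix.vecMulVec (fun i => x i t) (fun i => x i t)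

/-- The statistic `n² a⁻⁴ tr(S²) - 2 n (n + p - 2) a⁻⁴ tr(S) + n p (n + p - 2) a⁻⁴` with
`a = a_{np}`, where `S` is the sample covariance matrix of the data `x`. -/
noncomputable def centeredTrace (F : Measure ℝ) {p n : ℕ} (x : Fin p → Fin n → ℝ) : ℝ :=
  (n : ℝ) ^ 2 / tailQuantile F (n * p) ^ 4 * (sampleCov x ^ 2).trace
    - 2 * (n : ℝ) * ((n : ℝ) + (p : ℝ) - 2) / tailQuantile F (n * p) ^ 4 * (sampleCov x).trace
    + (n : ℝ) * (p : ℝ) * ((n : ℝ) + (p : ℝ) - 2) / tailQuantile F (n * p) ^ 4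

/-- A law `μ` on `ℝ` is `β`-stable: if `Z₁, Z₂` are independent with law `μ`, then for all
`A, B > 0` there is `D` such that `A Z₁ + B Z₂` has the law of `(A ^ β + B ^ β) ^ (1 / β) Z₁ + D`. -/
def StableLaw (μ : Measure ℝ) (β : ℝ) : Prop :=
  ∀ A B : ℝ, 0 < A → 0 < B → ∃ D : ℝ,
    (μ.map (fun x => A * x)).conv (μ.map (fun x => B * x))
      = μ.map (fun x => (A ^ β + B ^ β) ^ (1 / β) * x + D)

/-- `(e^{itx} - 1 - itx / (1 + x²)) x^{-(β + 1)}`. -/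
noncomputable def stableIntegrand (β t x : ℝ) : ℂ :=
  (Complex.exp (Complex.I * t * x) - 1 - Complex.I * t * x / (1 + (x : ℂ) ^ 2))
    * ((x ^ (-(β + 1)) : ℝ) : ℂ)

/-! The centring makes the expansion of the trace exact. Expand `n² tr(S²)` as a sum over `i, j, s,
t` of `x_{is} x_{it} x_{js} x_{jt}`, separate the cases `i = j` and `s = t`, and put `y = x² - 1`.
The terms in `tr(S)` and the constant are precisely what turns products of `x²` into products of `y`
(`centeredTrace_eq`). With `a = a_{np}`, the statistic equals `a⁻⁴ ∑ x_{it}⁴` plus `a⁻⁴` times three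
off-diagonal forms: products of `y` along rows, along columns, and products of `x` over the corners
of rectangles.

The diagonal sum has `np` i.i.d. nonnegative terms with tail index `β = α/4 < 1`, so it needs no
centring. Since `k P(X⁴ / a_k⁴ > v) → v^{-β}`, integration by parts gives `k E[e^{itX⁴/a_k⁴} - 1] →
β ∫₀^∞ (e^{itx} - 1) x^{-β-1} dx`; the small values of `X⁴` are controlled by Karamata's bound
(`RegularTail.tendsto_mul_integral_exp_sub_one`). The limit is the one-sided strictly stable law,
and the constant `c` only accounts for the term `itx / (1 + x²)`.

The off-diagonal forms vanish in the limit. Distinct square-free monomials in independent centred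
variables are orthogonal, so `rectForm` is of order `np` in `L²`, and `np / a⁴ → 0` because `α < 4`.
The variables `y` have infinite variance and are truncated at `|x| ≤ K a`, which changes some entry
with probability at most about `K^{-α}`. After truncation the variance `s` and the mean `c` satisfy
`np s = O(a⁴)` and `np |c| = O(a²)` (Karamata again), so the row form is `O(a⁴ / √p)` and the column
form `O(a⁴ / √n)` in `L¹` (`rowBound_le`). Both dimensions must grow, but at no particular relative
rate. Finally `K` is taken large. -/

/-! ### The exponent of the one-sided stable law -/

/-- `∫₀^∞ (e^{itx} - 1) x^{-(β + 1)} dx`. -/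
noncomputable def stableExponent (β t : ℝ) : ℂ :=
  ∫ x in Set.Ioi (0 : ℝ), (Complex.exp (Complex.I * t * x) - 1) * ((x ^ (-(β + 1)) : ℝ) : ℂ)

lemma norm_exp_I_mul_sub_one_le (t x : ℝ) :
    ‖Complex.exp (Complex.I * t * x) - 1‖ ≤ |t| * |x| := by
  have h := Real.norm_exp_I_mul_ofReal_sub_one_le (x := t * x)
  rw [Complex.ofReal_mul, ← mul_assoc] at h
  simpa [abs_mul] using h

lemma norm_exp_I_mul_sub_one_le_two (t x : ℝ) :
    ‖Complex.exp (Complex.I * t * x) - 1‖ ≤ 2 := by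
  calc ‖Complex.exp (Complex.I * t * x) - 1‖
      ≤ ‖Complex.exp (Complex.I * t * x)‖ + ‖(1 : ℂ)‖ := norm_sub_le _ _
    _ = 2 := by
      rw [mul_assoc, ← Complex.ofReal_mul, Complex.norm_exp_I_mul_ofReal]; norm_num

/-- Linear growth of `g` at the origin leaves the singularity `x^{-β}`, integrable as `β < 1`; at
infinity boundedness suffices as `β > 0`. -/
lemma integrableOn_mul_rpow_Ioi {β : ℝ} (hβ : 0 < β) (hβ' : β < 1) {g : ℝ → ℂ} (hg : Measurable g)
    {C D : ℝ} (hC : ∀ x, 0 < x → x ≤ 1 → ‖g x‖ ≤ C * x) (hD : ∀ x, 1 < x → ‖g x‖ ≤ D) :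
    IntegrableOn (fun x : ℝ => g x * ((x ^ (-(β + 1)) : ℝ) : ℂ)) (Set.Ioi 0) := by
  have hm : Measurable fun x : ℝ => g x * ((x ^ (-(β + 1)) : ℝ) : ℂ) := by fun_prop
  rw [← Set.Ioc_union_Ioi_eq_Ioi zero_le_one]
  refine IntegrableOn.union ?_ ?_
  · have h1 : IntegrableOn (fun x : ℝ => C * x ^ (-β)) (Set.Ioc 0 1) := by
      have := (intervalIntegral.intervalIntegrable_rpow' (a := 0) (b := 1)
        (r := -β) (by linarith)).const_mul C
      rwa [intervalIntegrable_iff_integrableOn_Ioc_of_le zero_le_one] at this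
    refine Integrable.mono' h1 hm.aestronglyMeasurable ?_
    refine (ae_restrict_iff' measurableSet_Ioc).2 (ae_of_all _ fun x hx => ?_)
    have hp : 0 ≤ x ^ (-(β + 1)) := Real.rpow_nonneg hx.1.le _
    have he : x ^ (-β) = x * x ^ (-(β + 1)) := by
      rw [← Real.rpow_one_add' hx.1.le (by linarith)]; ring_nf
    rw [norm_mul, Complex.norm_real, Real.norm_of_nonneg hp, he, ← mul_assoc]
    exact mul_le_mul_of_nonneg_right (hC x hx.1 hx.2) hp
  · have h1 : IntegrableOn (fun x : ℝ => D * x ^ (-(β + 1))) (Set.Ioi 1) :=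
      (integrableOn_Ioi_rpow_of_lt (by linarith) zero_lt_one).const_mul D
    refine Integrable.mono' h1 hm.aestronglyMeasurable ?_
    refine (ae_restrict_iff' measurableSet_Ioi).2 (ae_of_all _ fun x hx => ?_)
    have hx0 : (0 : ℝ) < x := lt_trans zero_lt_one hx
    have hp : 0 ≤ x ^ (-(β + 1)) := Real.rpow_nonneg hx0.le _
    rw [norm_mul, Complex.norm_real, Real.norm_of_nonneg hp]
    exact mul_le_mul_of_nonneg_right (hD x hx) hp

lemma integrableOn_exp_sub_one_mul_rpow {β : ℝ} (hβ : 0 < β) (hβ' : β < 1) (t : ℝ) :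
    IntegrableOn (fun x : ℝ => (Complex.exp (Complex.I * t * x) - 1) *
      ((x ^ (-(β + 1)) : ℝ) : ℂ)) (Set.Ioi 0) :=
  integrableOn_mul_rpow_Ioi hβ hβ' (C := |t|) (D := 2)
    (g := fun x : ℝ => Complex.exp (Complex.I * t * x) - 1) (by fun_prop)
    (fun x hx _ => by simpa [abs_of_pos hx] using norm_exp_I_mul_sub_one_le t x)
    fun x _ => norm_exp_I_mul_sub_one_le_two t x

/-- The drift `∫₀^∞ x / (1 + x²) x^{-(β + 1)} dx` that compensates the truncation function. -/
noncomputable def stableDrift (β : ℝ) : ℝ :=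
  ∫ x in Set.Ioi (0 : ℝ), x / (1 + x ^ 2) * x ^ (-(β + 1))

lemma integrableOn_stableDrift {β : ℝ} (hβ : 0 < β) (hβ' : β < 1) :
    IntegrableOn (fun x : ℝ => ((x / (1 + x ^ 2) * x ^ (-(β + 1)) : ℝ) : ℂ)) (Set.Ioi 0) := by
  have := integrableOn_mul_rpow_Ioi hβ hβ' (C := 1) (D := 1)
    (g := fun x : ℝ => ((x / (1 + x ^ 2) : ℝ) : ℂ)) (by fun_prop) ?_ ?_
  · simpa only [Complex.ofReal_mul] using this
  · intro x hx _
    rw [Complex.norm_real, Real.norm_of_nonneg (by positivity), one_mul,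
      div_le_iff₀ (by positivity)]
    nlinarith [sq_nonneg x]
  · intro x hx
    rw [Complex.norm_real, Real.norm_of_nonneg (by positivity), div_le_iff₀ (by positivity)]
    nlinarith [sq_nonneg (x - 1)]

lemma stableIntegrand_eq (β t x : ℝ) :
    stableIntegrand β t x = (Complex.exp (Complex.I * t * x) - 1) * ((x ^ (-(β + 1)) : ℝ) : ℂ)
      - Complex.I * t * ((x / (1 + x ^ 2) * x ^ (-(β + 1)) : ℝ) : ℂ) := by
  simp only [stableIntegrand]
  push_cast
  ring

lemma integrableOn_stableIntegrand {β : ℝ} (hβ : 0 < β) (hβ' : β < 1) (t : ℝ) :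
    IntegrableOn (stableIntegrand β t) (Set.Ioi 0) := by
  rw [show stableIntegrand β t = _ from funext (stableIntegrand_eq β t)]
  exact (integrableOn_exp_sub_one_mul_rpow hβ hβ' t).sub
    ((integrableOn_stableDrift hβ hβ').const_mul _)

lemma integral_stableIntegrand {β : ℝ} (hβ : 0 < β) (hβ' : β < 1) (t : ℝ) :
    ∫ x in Set.Ioi (0 : ℝ), stableIntegrand β t x
      = stableExponent β t - Complex.I * t * stableDrift β := by
  rw [show stableIntegrand β t = _ from funext (stableIntegrand_eq β t),
    integral_sub (integrableOn_exp_sub_one_mul_rpow hβ hβ' t)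
      ((integrableOn_stableDrift hβ hβ').const_mul _), integral_const_mul, integral_complex_ofReal]
  rfl

/-- Substituting `A x` for `x` makes the exponent homogeneous of degree `β`, which is the source of
stability. -/
lemma stableExponent_mul {β A : ℝ} (hA : 0 < A) (t : ℝ) :
    stableExponent β (A * t) = ((A ^ β : ℝ) : ℂ) * stableExponent β t := by
  have h := integral_comp_mul_left_Ioi (fun x : ℝ => (Complex.exp (Complex.I * t * x) - 1) *
    ((x ^ (-(β + 1)) : ℝ) : ℂ)) 0 hA
  rw [mul_zero] at h
  have h2 : stableExponent β (A * t) = ((A ^ (β + 1) : ℝ) : ℂ) *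
      ∫ x in Set.Ioi (0 : ℝ), (Complex.exp (Complex.I * t * (A * x : ℝ)) - 1) *
        (((A * x) ^ (-(β + 1)) : ℝ) : ℂ) := by
    rw [stableExponent, ← integral_const_mul]
    refine setIntegral_congr_fun measurableSet_Ioi fun x hx => ?_
    have hx' : (0 : ℝ) < x := hx
    have : x ^ (-(β + 1)) = A ^ (β + 1) * (A * x) ^ (-(β + 1)) := by
      rw [Real.mul_rpow hA.le hx'.le, ← mul_assoc, ← Real.rpow_add hA]; simp
    rw [this]
    push_cast
    ring_nf
  rw [h2, h, stableExponent, Complex.real_smul, ← mul_assoc, ← Complex.ofReal_mul,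
    Real.rpow_add hA, Real.rpow_one, mul_assoc, mul_inv_cancel₀ hA.ne', mul_one]

lemma stableExponent_zero (β : ℝ) : stableExponent β 0 = 0 := by simp [stableExponent]

/-- Homogeneity reduces everything to `t = ±1`; continuity at `0` follows. -/
lemma norm_stableExponent_le (β : ℝ) (hβ : 0 < β) (t : ℝ) :
    ‖stableExponent β t‖ ≤ |t| ^ β * (‖stableExponent β 1‖ + ‖stableExponent β (-1)‖) := by
  rcases lt_trichotomy t 0 with ht | rfl | ht
  · have h := stableExponent_mul (β := β) (neg_pos.2 ht) (-1)
    rw [show -t * -1 = t by ring] at h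
    rw [h, norm_mul, abs_of_neg ht, Complex.norm_real,
      Real.norm_of_nonneg (Real.rpow_nonneg (by linarith) _)]
    gcongr
    · exact Real.rpow_nonneg (by linarith) _
    · simp
  · simp [stableExponent_zero, Real.zero_rpow hβ.ne']
  · have h := stableExponent_mul (β := β) ht 1
    rw [mul_one] at h
    rw [h, norm_mul, abs_of_pos ht, Complex.norm_real,
      Real.norm_of_nonneg (Real.rpow_nonneg ht.le _)]
    gcongr
    simp

lemma continuousAt_stableExponent_zero {β : ℝ} (hβ : 0 < β) :
    ContinuousAt (stableExponent β) 0 := by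
  rw [ContinuousAt, stableExponent_zero]
  refine squeeze_zero_norm (norm_stableExponent_le β hβ) ?_
  have : ContinuousAt (fun t : ℝ => |t| ^ β * (‖stableExponent β 1‖ + ‖stableExponent β (-1)‖)) 0 :=
    ((continuous_abs.continuousAt).rpow_const (Or.inr hβ.le)).mul continuousAt_const
  simpa [ContinuousAt, Real.zero_rpow hβ.ne'] using this

/-- The real part is minus the integral of `(1 - cos x) x^{-(β + 1)}`, whose integrand is positive
on `(0, π)`. This excludes Dirac masses. -/
lemma re_stableExponent_one_neg {β : ℝ} (hβ : 0 < β) (hβ' : β < 1) :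
    (stableExponent β 1).re < 0 := by
  have hi := integrableOn_exp_sub_one_mul_rpow hβ hβ' 1
  have hre : ∀ x : ℝ, ((Complex.exp (Complex.I * (1 : ℝ) * x) - 1) *
      ((x ^ (-(β + 1)) : ℝ) : ℂ)).re = -((1 - Real.cos x) * x ^ (-(β + 1))) := by
    intro x
    rw [Complex.re_mul_ofReal, Complex.ofReal_one, mul_one, mul_comm, Complex.sub_re,
      mul_comm Complex.I, Complex.exp_ofReal_mul_I_re]
    simp; ring
  have h1 : (stableExponent β 1).re =
      -∫ x in Set.Ioi (0 : ℝ), (1 - Real.cos x) * x ^ (-(β + 1)) := by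
    rw [stableExponent, ← integral_neg]
    have := integral_re hi
    simp only [RCLike.re_to_complex] at this
    rw [← this]
    exact integral_congr_ae (ae_of_all _ hre)
  have hi2 : IntegrableOn (fun x : ℝ => (1 - Real.cos x) * x ^ (-(β + 1))) (Set.Ioi 0) := by
    have := hi.re.neg
    refine this.congr (ae_of_all _ fun x => ?_)
    have := hre x
    simp only [Pi.neg_apply, RCLike.re_to_complex]
    linarith
  rw [h1, neg_lt_zero]
  have hnn : ∀ x ∈ Set.Ioi (0 : ℝ), 0 ≤ (1 - Real.cos x) * x ^ (-(β + 1)) := fun x hx =>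
    mul_nonneg (by linarith [Real.cos_le_one x]) (Real.rpow_nonneg (le_of_lt hx) _)
  rw [setIntegral_pos_iff_support_of_nonneg_ae
    ((ae_restrict_iff' measurableSet_Ioi).2 (ae_of_all _ hnn)) hi2]
  refine lt_of_lt_of_le ?_ (measure_mono (s := Set.Ioo 0 Real.pi) ?_)
  · simp [Real.pi_pos]
  · rintro x ⟨hx0, hx1⟩
    refine ⟨?_, hx0⟩
    have hc : Real.cos x < 1 := by
      have := Real.cos_lt_cos_of_nonneg_of_le_pi (x := 0) (y := x) le_rfl hx1.le hx0
      simpa using this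
    exact (mul_pos (by linarith) (Real.rpow_pos_of_pos hx0 _)).ne'

/-! ### Existence and stability of the limit law -/

/-- Existence part of Lévy's continuity theorem. -/
lemma exists_charFun_eq_of_tendsto {μ : ℕ → ProbabilityMeasure ℝ} {φ : ℝ → ℂ}
    (hφ : ContinuousAt φ 0)
    (h : ∀ t, Tendsto (fun n => charFun (μ n : Measure ℝ) t) atTop (𝓝 (φ t))) :
    ∃ ζ : ProbabilityMeasure ℝ, ∀ t, charFun (ζ : Measure ℝ) t = φ t := by
  -- Continuity of `φ` at `0` prevents mass from escaping to infinity; Prokhorov's theorem then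
  -- gives a convergent subsequence, whose limit has characteristic function `φ`.
  have htight := isTightMeasureSet_of_tendsto_charFun (μ := fun n => (μ n : Measure ℝ)) hφ h
  have hc : IsCompact (closure (Set.range μ)) := by
    refine isCompact_closure_of_isTightMeasureSet ?_
    convert htight using 1
    ext ν
    simp [Set.mem_range]
  obtain ⟨ζ, -, n, hn, hζ⟩ := hc.tendsto_subseq fun n => subset_closure (Set.mem_range_self n)
  refine ⟨ζ, fun t => ?_⟩
  have h1 := (ProbabilityMeasure.tendsto_iff_tendsto_charFun.1 hζ) t
  exact tendsto_nhds_unique h1 ((h t).comp hn.tendsto_atTop)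

/-- Up to the factor `r s ^ r`, a Pareto law is the measure `x^{-(r + 1)} dx` cut off below `s`, so
sums of Pareto variables approximate the stable law. -/
lemma charFun_paretoMeasure_sub_one {s r : ℝ} (hs : 0 < s) (hr : 0 < r) (t : ℝ) :
    charFun (paretoMeasure s r) t - 1 = ((r * s ^ r : ℝ) : ℂ) *
      ∫ x in Set.Ici s, (Complex.exp (Complex.I * t * x) - 1) * ((x ^ (-(r + 1)) : ℝ) : ℂ) := by
  have := isProbabilityMeasure_paretoMeasure hs hr
  have hint : Integrable (fun x : ℝ => Complex.exp (Complex.I * t * x)) (paretoMeasure s r) := by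
    refine Integrable.of_bound (by fun_prop) 1 (ae_of_all _ fun x => ?_)
    rw [mul_assoc, ← Complex.ofReal_mul, Complex.norm_exp_I_mul_ofReal]
  have h1 : charFun (paretoMeasure s r) t - 1
      = ∫ x, (Complex.exp (Complex.I * t * x) - 1) ∂(paretoMeasure s r) := by
    rw [integral_sub hint (integrable_const _), charFun_apply_real]
    simp only [integral_const, probReal_univ, one_smul]
    congr 2
    ext x
    ring_nf
  rw [h1, paretoMeasure, integral_withDensity_eq_integral_toReal_smul
    (by unfold paretoPDF; fun_prop) (ae_of_all _ fun x => by simp [paretoPDF]),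
    ← integral_const_mul, ← integral_indicator measurableSet_Ici]
  congr 1
  ext x
  rw [paretoPDF, ENNReal.toReal_ofReal (paretoPDFReal_nonneg hs.le hr.le x), paretoPDFReal]
  by_cases hx : s ≤ x
  · rw [Set.indicator_of_mem (show x ∈ Set.Ici s from hx), if_pos hx, Complex.real_smul]
    push_cast
    ring
  · rw [Set.indicator_of_notMem (show x ∉ Set.Ici s from hx), if_neg hx, zero_smul]

lemma tendsto_setIntegral_Ici {f : ℝ → ℂ} (hf : IntegrableOn f (Set.Ioi 0)) {s : ℕ → ℝ}
    (hs : ∀ n, 0 < s n) (hs' : Tendsto s atTop (𝓝 0)) :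
    Tendsto (fun n => ∫ x in Set.Ici (s n), f x) atTop (𝓝 (∫ x in Set.Ioi (0 : ℝ), f x)) := by
  simp_rw [← integral_indicator measurableSet_Ici, ← integral_indicator measurableSet_Ioi]
  refine tendsto_integral_of_dominated_convergence (fun x => ‖(Set.Ioi (0 : ℝ)).indicator f x‖)
    (fun n => ?_) (hf.integrable_indicator measurableSet_Ioi).norm (fun n => ae_of_all _ fun x => ?_)
    (ae_of_all _ fun x => ?_)
  · exact ((hf.mono_set fun x hx => lt_of_lt_of_le (hs n) hx).integrable_indicator
      measurableSet_Ici).aestronglyMeasurable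
  · by_cases hx : x ∈ Set.Ici (s n)
    · rw [Set.indicator_of_mem hx,
        Set.indicator_of_mem (show x ∈ Set.Ioi 0 from lt_of_lt_of_le (hs n) hx)]
    · rw [Set.indicator_of_notMem hx]; simp
  · by_cases hx : 0 < x
    · refine tendsto_const_nhds.congr' ?_
      filter_upwards [hs'.eventually_le_const hx] with n hn
      rw [Set.indicator_of_mem (show x ∈ Set.Ici (s n) from hn),
        Set.indicator_of_mem (show x ∈ Set.Ioi 0 from hx)]
    · refine tendsto_const_nhds.congr fun n => ?_
      rw [Set.indicator_of_notMem (show x ∉ Set.Ioi (0 : ℝ) from hx),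
        Set.indicator_of_notMem (show x ∉ Set.Ici (s n) from fun h => hx ((hs n).trans_le h))]

/-- The one-sided `β`-stable law with Lévy measure `β x^{-(β + 1)} dx` exists. -/
lemma exists_charFun_eq_exp_stableExponent {β : ℝ} (hβ : 0 < β) (hβ' : β < 1) :
    ∃ ζ : ProbabilityMeasure ℝ, ∀ t, charFun (ζ : Measure ℝ) t
      = Complex.exp (β * stableExponent β t) := by
  -- Chosen so that `s n ^ β = 1 / (n + 1)`: then `n + 1` Pareto variables have total intensity `β
  -- x^{-(β + 1)}` on `[s n, ∞)`.
  let s : ℕ → ℝ := fun n => ((n : ℝ) + 1) ^ (-(1 / β))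
  have hs : ∀ n, 0 < s n := fun n => Real.rpow_pos_of_pos (by positivity) _
  have hs' : Tendsto s atTop (𝓝 0) :=
    (tendsto_rpow_neg_atTop (by positivity)).comp
      (tendsto_atTop_add_const_right _ _ tendsto_natCast_atTop_atTop)
  have hp : ∀ n, IsProbabilityMeasure (paretoMeasure (s n) β) :=
    fun n => isProbabilityMeasure_paretoMeasure (hs n) hβ
  let μ : ℕ → Measure ℝ := fun n =>
    (Measure.pi fun _ : Fin (n + 1) => paretoMeasure (s n) β).map (fun p => ∑ i, p i)
  have hμ : ∀ n, IsProbabilityMeasure (μ n) := fun n =>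
    Measure.isProbabilityMeasure_map (by fun_prop)
  refine exists_charFun_eq_of_tendsto (μ := fun n => ⟨μ n, hμ n⟩) ?_ fun t => ?_
  · exact (Complex.continuous_exp.continuousAt).comp
      (continuousAt_const.mul (continuousAt_stableExponent_zero hβ))
  · have h1 : ∀ n, charFun (μ n) t = (1 + (charFun (paretoMeasure (s n) β) t - 1)) ^ (n + 1) := by
      intro n
      simp only [μ]
      rw [charFun_map_sum_pi_eq_prod]
      simp
    simp only [ProbabilityMeasure.coe_mk, h1]
    -- Reindexing by one matches the exponent `n + 1` with the form `(1 + z n) ^ n` of the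
    -- exponential limit.
    refine (tendsto_add_atTop_iff_nat
      (f := fun n => (1 + (charFun (paretoMeasure (s (n - 1)) β) t - 1)) ^ n) 1).2
      (Complex.tendsto_one_add_pow_exp_of_tendsto ?_)
    rw [← tendsto_add_atTop_iff_nat 1]
    simp only [Nat.add_sub_cancel]
    refine ((tendsto_setIntegral_Ici (integrableOn_exp_sub_one_mul_rpow hβ hβ' t) hs
      hs').const_mul (β : ℂ)).congr fun n => ?_
    have hsn : s n ^ β = ((n : ℝ) + 1)⁻¹ := by
      simp only [s]
      rw [← Real.rpow_mul (by positivity), neg_mul, one_div, inv_mul_cancel₀ hβ.ne',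
        Real.rpow_neg_one]
    rw [charFun_paretoMeasure_sub_one (hs n) hβ, hsn, ← mul_assoc]
    congr 1
    push_cast
    field_simp

lemma stableLaw_of_charFun_eq {β : ℝ} (hβ : 0 < β) {ζ : ProbabilityMeasure ℝ}
    (hζ : ∀ t, charFun (ζ : Measure ℝ) t = Complex.exp (β * stableExponent β t)) :
    StableLaw (ζ : Measure ℝ) β := by
  intro A B hA hB
  -- No shift is needed: the uncompensated exponent is exactly homogeneous, so the law is strictly
  -- stable.
  refine ⟨0, ?_⟩
  have hAB : 0 < A ^ β + B ^ β :=
    add_pos (Real.rpow_pos_of_pos hA _) (Real.rpow_pos_of_pos hB _)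
  have : IsProbabilityMeasure ((ζ : Measure ℝ).map (fun x => A * x)) :=
    Measure.isProbabilityMeasure_map (by fun_prop)
  have : IsProbabilityMeasure ((ζ : Measure ℝ).map (fun x => B * x)) :=
    Measure.isProbabilityMeasure_map (by fun_prop)
  have : IsProbabilityMeasure ((ζ : Measure ℝ).map
      (fun x => (A ^ β + B ^ β) ^ (1 / β) * x + 0)) :=
    Measure.isProbabilityMeasure_map (by fun_prop)
  refine Measure.ext_of_charFun (funext fun t => ?_)
  simp only [add_zero]
  rw [charFun_conv, charFun_map_mul, charFun_map_mul, charFun_map_mul, hζ, hζ, hζ,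
    ← Complex.exp_add, stableExponent_mul hA, stableExponent_mul hB,
    stableExponent_mul (Real.rpow_pos_of_pos hAB _), ← Real.rpow_mul hAB.le,
    one_div_mul_cancel hβ.ne', Real.rpow_one]
  push_cast
  ring_nf

/-- A Dirac mass has a characteristic function of modulus one, whereas here the modulus at `t = 1`
is the exponential of a negative number. -/
lemma ne_dirac_of_charFun_eq {β : ℝ} (hβ : 0 < β) (hβ' : β < 1) {ζ : ProbabilityMeasure ℝ}
    (hζ : ∀ t, charFun (ζ : Measure ℝ) t = Complex.exp (β * stableExponent β t)) (z : ℝ) :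
    (ζ : Measure ℝ) ≠ Measure.dirac z := by
  intro h
  have h1 : ‖charFun (ζ : Measure ℝ) 1‖ = 1 := by
    rw [h, charFun_dirac, Complex.norm_exp_ofReal_mul_I]
  rw [hζ, Complex.norm_exp, Complex.re_ofReal_mul, Real.exp_eq_one_iff] at h1
  exact absurd h1 (mul_neg_of_pos_of_neg hβ (re_stableExponent_one_neg hβ hβ')).ne

/-! ### Regularly varying tails -/

/-- The tail function `P(|X| > x)` of a law `F`. -/
noncomputable def tail (F : Measure ℝ) (x : ℝ) : ℝ := F.real {y : ℝ | x < |y|}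

lemma tail_nonneg {F : Measure ℝ} (x : ℝ) : 0 ≤ tail F x := measureReal_nonneg

section Tail

variable {F : Measure ℝ} [IsProbabilityMeasure F]

lemma measurableSet_lt_abs (x : ℝ) : MeasurableSet {y : ℝ | x < |y|} :=
  measurableSet_lt measurable_const measurable_id.abs

lemma measurableSet_abs_le (x : ℝ) : MeasurableSet {y : ℝ | |y| ≤ x} :=
  measurableSet_le measurable_id.abs measurable_const

lemma tail_antitone : Antitone (tail F) := fun _ _ h =>
  measureReal_mono fun _ hy => lt_of_le_of_lt h hy

lemma tail_of_neg {x : ℝ} (hx : x < 0) : tail F x = 1 := by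
  have : {y : ℝ | x < |y|} = Set.univ :=
    Set.eq_univ_of_forall fun y => lt_of_lt_of_le hx (abs_nonneg y)
  simp [tail, this]

lemma tendsto_tail_atTop : Tendsto (tail F) atTop (𝓝 0) := by
  have h := tendsto_measure_iInter_atTop (μ := F) (s := fun x : ℝ => {y : ℝ | x < |y|})
    (fun x => (measurableSet_lt_abs x).nullMeasurableSet)
    (fun _ _ h _ hy => lt_of_le_of_lt h hy) ⟨0, measure_ne_top _ _⟩
  have he : ⋂ x : ℝ, {y : ℝ | x < |y|} = ∅ :=
    Set.eq_empty_of_forall_notMem fun y hy => lt_irrefl |y| (Set.mem_iInter.1 hy |y|)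
  rw [he, measure_empty] at h
  have := (ENNReal.tendsto_toReal ENNReal.zero_ne_top).comp h
  exact this

/-- Right-continuity of the tail; it shows that the infimum defining `tailQuantile` is attained. -/
lemma tail_le_of_forall_gt {a c : ℝ} (h : ∀ x, a < x → tail F x ≤ c) : tail F a ≤ c := by
  have hu : {y : ℝ | a < |y|} = ⋃ n : ℕ, {y : ℝ | a + 1 / ((n : ℝ) + 1) < |y|} := by
    ext y
    simp only [Set.mem_ofPred_eq, Set.mem_iUnion]
    constructor
    · intro hy
      obtain ⟨n, hn⟩ := exists_nat_one_div_lt (sub_pos.2 hy)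
      exact ⟨n, by linarith⟩
    · rintro ⟨n, hn⟩
      have : (0 : ℝ) < 1 / ((n : ℝ) + 1) := by positivity
      linarith
  have hm : Monotone fun n : ℕ => {y : ℝ | a + 1 / ((n : ℝ) + 1) < |y|} := by
    intro m n hmn y hy
    have : 1 / ((n : ℝ) + 1) ≤ 1 / ((m : ℝ) + 1) := by gcongr
    have hy' : a + 1 / ((m : ℝ) + 1) < |y| := hy
    exact lt_of_le_of_lt (by linarith) hy'
  have ht := tendsto_measure_iUnion_atTop (μ := F) hm
  rw [← hu] at ht
  have ht' := (ENNReal.tendsto_toReal (measure_ne_top F _)).comp ht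
  refine le_of_tendsto' ht' fun n => h _ ?_
  have : (0 : ℝ) < 1 / ((n : ℝ) + 1) := by positivity
  linarith

/-- For `k = 1` the set is all of `ℝ`; from `k = 2` on, negative points, where the tail is `1`, are
excluded. -/
lemma bddBelow_tail_le {k : ℕ} (hk : 2 ≤ k) : BddBelow {x : ℝ | tail F x ≤ 1 / (k : ℝ)} := by
  refine ⟨0, fun x hx => ?_⟩
  by_contra! hx0
  have h1 : tail F x ≤ 1 / (k : ℝ) := hx
  rw [tail_of_neg hx0, le_div_iff₀ (by positivity)] at h1
  have : (2 : ℝ) ≤ k := by exact_mod_cast hk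
  linarith

lemma nonempty_tail_le {k : ℕ} (hk : 0 < k) : {x : ℝ | tail F x ≤ 1 / (k : ℝ)}.Nonempty :=
  (tendsto_tail_atTop.eventually_le_const (by positivity : (0 : ℝ) < 1 / (k : ℝ))).exists

lemma tail_tailQuantile_le {k : ℕ} (hk : 0 < k) : tail F (tailQuantile F k) ≤ 1 / (k : ℝ) := by
  refine tail_le_of_forall_gt fun x hx => ?_
  obtain ⟨y, hy, hyx⟩ := exists_lt_of_csInf_lt (nonempty_tail_le hk) hx
  exact (tail_antitone hyx.le).trans hy

lemma lt_tail_of_lt_tailQuantile {k : ℕ} (hk : 2 ≤ k) {x : ℝ} (hx : x < tailQuantile F k) :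
    1 / (k : ℝ) < tail F x :=
  not_le.1 fun h => notMem_of_lt_csInf hx (bddBelow_tail_le hk) h

end Tail

/-- The tail of a regularly varying law is positive and satisfies
`tail F (t * x) / tail F x → t ^ (-α)`. -/
structure RegularTail (F : Measure ℝ) (α : ℝ) : Prop where
  tendsto_div : ∀ t : ℝ, 0 < t →
    Tendsto (fun x => tail F (t * x) / tail F x) atTop (𝓝 (t ^ (-α)))
  pos : ∀ x, 0 < tail F x

lemma RegularlyVaryingLaw.regularTail {F : Measure ℝ} [IsProbabilityMeasure F] {α : ℝ}
    (h : RegularlyVaryingLaw F α) : RegularTail F α := by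
  obtain ⟨L, hL, hFL⟩ := h
  have h1 : ∀ t : ℝ, 0 < t →
      Tendsto (fun x => tail F (t * x) / tail F x) atTop (𝓝 (t ^ (-α))) := by
    intro t ht
    have := (hL t ht).const_mul (t ^ (-α))
    rw [mul_one] at this
    refine this.congr' ?_
    filter_upwards [eventually_gt_atTop 0] with x hx
    have hxp : x ^ (-α) ≠ 0 := (Real.rpow_pos_of_pos hx _).ne'
    rw [tail, tail, hFL x hx, hFL (t * x) (by positivity), Real.mul_rpow ht.le hx.le, mul_right_comm,
      mul_comm (x ^ (-α)), mul_div_mul_right _ _ hxp, mul_div_assoc]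
  -- A tail that vanishes at one point vanishes beyond it, and the quotients, being `0 / 0 = 0`,
  -- could not tend to `1`.
  refine ⟨h1, fun x => (tail_nonneg x).lt_of_ne' fun hx => ?_⟩
  have h2 := h1 1 one_pos
  have h3 : Tendsto (fun x => tail F (1 * x) / tail F x) atTop (𝓝 0) := by
    refine tendsto_const_nhds.congr' ?_
    filter_upwards [eventually_ge_atTop x] with y hy
    have : tail F y = 0 := le_antisymm ((tail_antitone hy).trans hx.le) (tail_nonneg y)
    simp [this]
  have := tendsto_nhds_unique h2 h3
  simp at this

/-- Here `2 < α < 4` enters, as `1/16 < 2^{-α} < 1/4`. Iterated over dyadic scales, these one-step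
bounds play the role of Potter's bounds: `16 r₁ > 1` serves fourth moments, `4 r₂ < 1` second
moments. -/
lemma RegularTail.exists_doubling {F : Measure ℝ} {α : ℝ} (h : RegularTail F α) (hα : 2 < α) (hα' : α < 4) :
    ∃ r₁ r₂ x₀ : ℝ, 1 < 16 * r₁ ∧ 4 * r₂ < 1 ∧ 1 ≤ x₀ ∧
      ∀ x, x₀ ≤ x → r₁ * tail F x ≤ tail F (2 * x) ∧ tail F (2 * x) ≤ r₂ * tail F x := by
  have h16 : 1 / 16 < (2 : ℝ) ^ (-α) := by
    rw [show (1 : ℝ) / 16 = 2 ^ (-4 : ℝ) by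
      rw [Real.rpow_neg zero_le_two, show (4 : ℝ) = (4 : ℕ) by norm_num, Real.rpow_natCast]
      norm_num]
    exact Real.rpow_lt_rpow_of_exponent_lt one_lt_two (by linarith)
  have h4 : (2 : ℝ) ^ (-α) < 1 / 4 := by
    rw [show (1 : ℝ) / 4 = 2 ^ (-2 : ℝ) by
      rw [Real.rpow_neg zero_le_two, show (2 : ℝ) = (2 : ℕ) by norm_num, Real.rpow_natCast]
      norm_num]
    exact Real.rpow_lt_rpow_of_exponent_lt one_lt_two (by linarith)
  obtain ⟨r₁, hr₁, hr₁'⟩ := exists_between h16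
  obtain ⟨r₂, hr₂, hr₂'⟩ := exists_between h4
  have hd := h.tendsto_div 2 two_pos
  obtain ⟨x₀, hx₀⟩ := eventually_atTop.1
    ((hd.eventually_const_lt hr₁').and (hd.eventually_lt_const hr₂))
  refine ⟨r₁, r₂, max x₀ 1, by linarith, by linarith, le_max_right _ _, fun x hx => ?_⟩
  obtain ⟨h1, h2⟩ := hx₀ x ((le_max_left _ _).trans hx)
  exact ⟨((lt_div_iff₀ (h.pos x)).1 h1).le, ((div_lt_iff₀ (h.pos x)).1 h2).le⟩

namespace RegularTail

variable {F : Measure ℝ} [IsProbabilityMeasure F] {α : ℝ}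

lemma tendsto_tailQuantile (h : RegularTail F α) : Tendsto (tailQuantile F) atTop atTop := by
  refine tendsto_atTop.2 fun M => ?_
  have : ∀ᶠ k : ℕ in atTop, 1 / (k : ℝ) < tail F M :=
    (tendsto_const_div_atTop_nhds_zero_nat 1).eventually_lt_const (h.pos M)
  filter_upwards [this, eventually_gt_atTop 0] with k hk hk0
  refine le_csInf (nonempty_tail_le hk0) fun x hx => ?_
  by_contra! hxM
  exact absurd ((tail_antitone hxM.le).trans hx) (not_le.2 hk)

/-- The upper bound holds because the infimum is attained. For the lower one, `s a_k` with `s < 1`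
lies below the infimum, so its tail exceeds `1 / k`, and regular variation costs only the factor `s
^ α`, close to `1`. -/
lemma tendsto_mul_tail_tailQuantile (h : RegularTail F α) :
    Tendsto (fun k : ℕ => (k : ℝ) * tail F (tailQuantile F k)) atTop (𝓝 1) := by
  refine tendsto_order.2 ⟨fun c hc => ?_, fun c hc => ?_⟩
  · have hs : Tendsto (fun s : ℝ => s ^ α) (𝓝[<] 1) (𝓝 1) := by
      have : ContinuousAt (fun s : ℝ => s ^ α) 1 := Real.continuousAt_rpow_const _ _ (by simp)
      simpa [ContinuousAt] using this.tendsto.mono_left nhdsWithin_le_nhds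
    obtain ⟨s, hcs, hs0, hs1⟩ := ((hs.eventually_const_lt hc).and
      (((eventually_gt_nhds zero_lt_one).filter_mono nhdsWithin_le_nhds).and
        self_mem_nhdsWithin)).exists
    have hs1' : s < 1 := hs1
    have h1 := (h.tendsto_div s⁻¹ (by positivity)).comp
      (h.tendsto_tailQuantile.const_mul_atTop hs0)
    rw [Real.inv_rpow hs0.le, Real.rpow_neg hs0.le, inv_inv] at h1
    filter_upwards [h1.eventually_const_lt hcs, h.tendsto_tailQuantile.eventually_gt_atTop 0,
      eventually_ge_atTop 2] with k hk ha hk2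
    refine hk.trans_le ?_
    have h2 : 1 / (k : ℝ) < tail F (s * tailQuantile F k) :=
      lt_tail_of_lt_tailQuantile hk2 (by nlinarith)
    have hk0 : (0 : ℝ) < k := by positivity
    simp only [Function.comp_apply]
    rw [← mul_assoc, inv_mul_cancel₀ hs0.ne', one_mul, div_le_iff₀ (h.pos _)]
    rw [div_lt_iff₀ hk0] at h2
    nlinarith [tail_nonneg (F := F) (tailQuantile F k)]
  · filter_upwards [eventually_gt_atTop 0] with k hk
    refine lt_of_le_of_lt ?_ hc
    have hk0 : (0 : ℝ) < k := by positivity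
    have := tail_tailQuantile_le (F := F) hk
    rwa [le_div_iff₀ hk0, mul_comm] at this

lemma tendsto_mul_tail_mul_tailQuantile (h : RegularTail F α) {t : ℝ} (ht : 0 < t) :
    Tendsto (fun k : ℕ => (k : ℝ) * tail F (t * tailQuantile F k)) atTop (𝓝 (t ^ (-α))) := by
  have := ((h.tendsto_div t ht).comp h.tendsto_tailQuantile).mul
    h.tendsto_mul_tail_tailQuantile
  rw [mul_one] at this
  refine this.congr fun k => ?_
  have := (h.pos (tailQuantile F k)).ne'
  simp only [Function.comp_apply]
  field_simp

end RegularTail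

/-! ### Karamata bounds by doubling -/

lemma tendsto_setIntegral_lt_abs {F : Measure ℝ} {f : ℝ → ℝ} (hf : Integrable f F) {b : ℝ} (hb : 0 < b) :
    Tendsto (fun n : ℕ => ∫ x in {x | 2 ^ n * b < |x|}, f x ∂F) atTop (𝓝 0) := by
  have h := tendsto_setIntegral_of_antitone (μ := F) (f := f)
    (s := fun n : ℕ => {x : ℝ | 2 ^ n * b < |x|}) (fun n => measurableSet_lt_abs _)
    (fun m n hmn x hx => lt_of_le_of_lt
      (mul_le_mul_of_nonneg_right (pow_le_pow_right₀ one_le_two hmn) hb.le)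
      (show 2 ^ n * b < |x| from hx))
    ⟨0, hf.integrableOn⟩
  have he : ⋂ n : ℕ, {x : ℝ | 2 ^ n * b < |x|} = ∅ := by
    refine Set.eq_empty_of_forall_notMem fun x hx => ?_
    obtain ⟨n, hn⟩ := pow_unbounded_of_one_lt (|x| / b) one_lt_two
    have := Set.mem_iInter.1 hx n
    exact absurd ((div_lt_iff₀ hb).1 hn) (not_lt.2 (le_of_lt this))
  simpa [he] using h

lemma doubling_induction {P : ℝ → Prop} {x₀ : ℝ} (hx₀ : 0 < x₀)
    (base : ∀ b, x₀ ≤ b → b ≤ 2 * x₀ → P b) (step : ∀ b, x₀ ≤ b → P b → P (2 * b)) :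
    ∀ b, x₀ ≤ b → P b := by
  have key : ∀ n : ℕ, ∀ b, x₀ ≤ b → b ≤ 2 ^ n * (2 * x₀) → P b := by
    intro n
    induction n with
    | zero => intro b hb hb'; exact base b hb (by simpa using hb')
    | succ n ih =>
      intro b hb hb'
      by_cases hb2 : b ≤ 2 * x₀
      · exact base b hb hb2
      · rw [show b = 2 * (b / 2) by ring]
        refine step _ (by linarith) (ih _ (by linarith) ?_)
        rw [pow_succ] at hb'
        linarith
  intro b hb
  obtain ⟨n, hn⟩ := pow_unbounded_of_one_lt (b / (2 * x₀)) one_lt_two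
  exact key n b hb ((div_lt_iff₀ (by positivity)).1 hn).le

namespace RegularTail

variable {F : Measure ℝ} [IsProbabilityMeasure F] {α : ℝ}

lemma integrableOn_pow_four (F : Measure ℝ) [IsProbabilityMeasure F] (b : ℝ) :
    IntegrableOn (fun x : ℝ => x ^ 4) {x | |x| ≤ b} F := by
  refine Measure.integrableOn_of_bounded (M := b ^ 4) (measure_ne_top _ _) (by fun_prop) ?_
  refine (ae_restrict_iff' (measurableSet_abs_le b)).2 (ae_of_all _ fun x hx => ?_)
  rw [norm_pow]
  exact pow_le_pow_left₀ (norm_nonneg _) hx _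

/-- Karamata's bound for the truncated fourth moment. -/
lemma exists_integral_pow_four_le (h : RegularTail F α) (hα : 2 < α) (hα' : α < 4) :
    ∃ C x₀ : ℝ, 0 ≤ C ∧ ∀ b, x₀ ≤ b →
      ∫ x in {x | |x| ≤ b}, x ^ 4 ∂F ≤ C * b ^ 4 * tail F b := by
  obtain ⟨r₁, r₂, x₀, hr₁, -, hx₀, hd⟩ := h.exists_doubling hα hα'
  have hG := h.pos (2 * x₀)
  -- The first entry gives `C + 16 ≤ 16 r₁ C`, where `16` pays for the shell `b < |x| ≤ 2b` in the
  -- doubling step; the second covers the base range `x₀ ≤ b ≤ 2 x₀`.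
  set C := max (16 / (16 * r₁ - 1)) (16 / tail F (2 * x₀)) with hC
  have hC1 : 16 ≤ C * (16 * r₁ - 1) := (div_le_iff₀ (by linarith)).1 (le_max_left _ _)
  have hC2 : 16 ≤ C * tail F (2 * x₀) := (div_le_iff₀ hG).1 (le_max_right _ _)
  have hC0 : 0 ≤ C := le_trans (by positivity) (le_max_right _ _)
  have hbound : ∀ (s : Set ℝ) (b : ℝ), MeasurableSet s → (∀ x ∈ s, |x| ≤ b) →
      ∫ x in s, x ^ 4 ∂F ≤ b ^ 4 * F.real s := by
    intro s b hs hsb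
    have hi : IntegrableOn (fun x : ℝ => x ^ 4) s F := (integrableOn_pow_four F b).mono_set hsb
    calc ∫ x in s, x ^ 4 ∂F ≤ ∫ _ in s, b ^ 4 ∂F := by
          refine setIntegral_mono_on hi (integrable_const _) hs fun x hx => ?_
          rw [← Even.pow_abs (by decide)]
          exact pow_le_pow_left₀ (abs_nonneg _) (hsb x hx) _
      _ = b ^ 4 * F.real s := by simp [mul_comm]
  refine ⟨C, x₀, hC0, doubling_induction (by linarith) (fun b hb hb' => ?_) fun b hb ih => ?_⟩
  · calc ∫ x in {x | |x| ≤ b}, x ^ 4 ∂F ≤ b ^ 4 * F.real {x | |x| ≤ b} :=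
          hbound _ b (measurableSet_abs_le b) fun x hx => hx
      _ ≤ b ^ 4 * 1 := by gcongr; exact measureReal_le_one
      _ ≤ b ^ 4 * (C * tail F (2 * x₀)) := by gcongr; linarith
      _ ≤ b ^ 4 * (C * tail F b) := by gcongr; exact tail_antitone hb'
      _ = C * b ^ 4 * tail F b := by ring
  · have hb0 : 0 ≤ b := by linarith
    have hsplit : {x : ℝ | |x| ≤ 2 * b} = {x | |x| ≤ b} ∪ {x | b < |x| ∧ |x| ≤ 2 * b} := by
      ext x
      simp only [Set.mem_ofPred_eq, Set.mem_union]
      constructor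
      · intro hx
        by_cases hxb : |x| ≤ b
        · exact Or.inl hxb
        · exact Or.inr ⟨not_le.1 hxb, hx⟩
      · rintro (hx | hx)
        · linarith
        · exact hx.2
    have hm : MeasurableSet {x : ℝ | b < |x| ∧ |x| ≤ 2 * b} :=
      (measurableSet_lt_abs b).inter (measurableSet_abs_le _)
    have hdisj : Disjoint {x : ℝ | |x| ≤ b} {x : ℝ | b < |x| ∧ |x| ≤ 2 * b} :=
      Set.disjoint_left.2 fun x hx hx' => absurd hx (not_le.2 hx'.1)
    rw [hsplit, setIntegral_union hdisj hm
      (integrableOn_pow_four F b) ((integrableOn_pow_four F (2 * b)).mono_set fun x hx => hx.2)]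
    have h1 := hbound {x : ℝ | b < |x| ∧ |x| ≤ 2 * b} (2 * b) hm fun x hx => hx.2
    have h2 : F.real {x : ℝ | b < |x| ∧ |x| ≤ 2 * b} ≤ tail F b :=
      measureReal_mono fun x hx => hx.1
    have h3 := (hd b hb).1
    have h4 : (2 * b) ^ 4 * F.real {x : ℝ | b < |x| ∧ |x| ≤ 2 * b} ≤ (2 * b) ^ 4 * tail F b := by
      gcongr
    have hG0 := tail_nonneg (F := F) b
    calc _ ≤ C * b ^ 4 * tail F b + (2 * b) ^ 4 * tail F b := add_le_add ih (h1.trans h4)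
      _ = b ^ 4 * tail F b * (C + 16) := by ring
      _ ≤ b ^ 4 * tail F b * (C * (16 * r₁)) := by gcongr; linarith
      _ = C * (2 * b) ^ 4 * (r₁ * tail F b) := by ring
      _ ≤ C * (2 * b) ^ 4 * tail F (2 * b) := by gcongr

/-- Each doubling of `b` multiplies the quantity by at least `16 r₁ > 1`, so it grows at least like
`b ^ γ` with `2 ^ γ = 16 r₁`. -/
lemma tendsto_pow_four_mul_tail (h : RegularTail F α) (hα : 2 < α) (hα' : α < 4) :
    Tendsto (fun b => b ^ 4 * tail F b) atTop atTop := by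
  obtain ⟨r₁, r₂, x₀, hr₁, -, hx₀, hd⟩ := h.exists_doubling hα hα'
  have hG := h.pos (2 * x₀)
  set γ := Real.logb 2 (16 * r₁) with hγ
  have hγ0 : 0 < γ := Real.logb_pos one_lt_two hr₁
  have hγ2 : (2 : ℝ) ^ γ = 16 * r₁ := Real.rpow_logb two_pos (by norm_num) (by linarith)
  have hx0 : 0 < x₀ := by linarith
  set c := x₀ ^ 4 * tail F (2 * x₀) / (2 * x₀) ^ γ with hc
  have hc0 : 0 < c := by positivity
  have key : ∀ b, x₀ ≤ b → c * b ^ γ ≤ b ^ 4 * tail F b := by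
    refine doubling_induction hx0 (fun b hb hb' => ?_) fun b hb ih => ?_
    · have hb0 : 0 < b := by linarith
      calc c * b ^ γ ≤ c * (2 * x₀) ^ γ := by gcongr
        _ = x₀ ^ 4 * tail F (2 * x₀) := by rw [hc]; field_simp
        _ ≤ b ^ 4 * tail F b := by
          gcongr
          exact tail_antitone hb'
    · have hb0 : 0 < b := by linarith
      calc c * (2 * b) ^ γ = 16 * r₁ * (c * b ^ γ) := by
            rw [Real.mul_rpow two_pos.le hb0.le, hγ2]; ring
        _ ≤ 16 * r₁ * (b ^ 4 * tail F b) := by gcongr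
        _ = (2 * b) ^ 4 * (r₁ * tail F b) := by ring
        _ ≤ (2 * b) ^ 4 * tail F (2 * b) := by gcongr; exact (hd b hb).1
  exact tendsto_atTop_mono' _ ((eventually_ge_atTop x₀).mono key)
    ((tendsto_rpow_atTop hγ0).const_mul_atTop hc0)

/-- Karamata's bound for the tail of the second moment. -/
lemma exists_integral_sq_le (h : RegularTail F α) (hα : 2 < α) (hα' : α < 4)
    (hi : Integrable (fun x : ℝ => x ^ 2) F) :
    ∃ C x₀ : ℝ, 0 ≤ C ∧ ∀ b, x₀ ≤ b →
      ∫ x in {x | b < |x|}, x ^ 2 ∂F ≤ C * b ^ 2 * tail F b := by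
  obtain ⟨r₁, r₂, x₀, -, hr₂, hx₀, hd⟩ := h.exists_doubling hα hα'
  -- Solves `4 r₂ C = C - 4`: the decrease of the tail term under doubling pays for the shell `b <
  -- |x| ≤ 2b`, which contributes at most `4 b² tail F b`.
  set C := 4 / (1 - 4 * r₂) with hC
  have hC0 : 0 ≤ C := div_nonneg (by norm_num) (by linarith)
  have hC1 : C * (1 - 4 * r₂) = 4 := div_mul_cancel₀ _ (by linarith)
  set D : ℝ → ℝ := fun b => ∫ x in {x | b < |x|}, x ^ 2 ∂F - C * b ^ 2 * tail F b with hD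
  have step : ∀ b, x₀ ≤ b → D b ≤ D (2 * b) := by
    intro b hb
    have hb0 : 0 ≤ b := by linarith
    have hsplit : {x : ℝ | b < |x|} = {x | b < |x| ∧ |x| ≤ 2 * b} ∪ {x | 2 * b < |x|} := by
      ext x
      simp only [Set.mem_ofPred_eq, Set.mem_union]
      constructor
      · intro hx
        by_cases hxb : |x| ≤ 2 * b
        · exact Or.inl ⟨hx, hxb⟩
        · exact Or.inr (not_le.1 hxb)
      · rintro (hx | hx)
        · exact hx.1
        · linarith
    have hm : MeasurableSet {x : ℝ | b < |x| ∧ |x| ≤ 2 * b} :=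
      (measurableSet_lt_abs b).inter (measurableSet_abs_le _)
    have h1 : ∫ x in {x | b < |x| ∧ |x| ≤ 2 * b}, x ^ 2 ∂F ≤ (2 * b) ^ 2 * tail F b := by
      calc ∫ x in {x | b < |x| ∧ |x| ≤ 2 * b}, x ^ 2 ∂F
          ≤ ∫ _ in {x | b < |x| ∧ |x| ≤ 2 * b}, (2 * b) ^ 2 ∂F := by
            refine setIntegral_mono_on hi.integrableOn (integrable_const _) hm fun x hx => ?_
            rw [← sq_abs]
            exact pow_le_pow_left₀ (abs_nonneg _) hx.2 _
        _ = (2 * b) ^ 2 * F.real {x | b < |x| ∧ |x| ≤ 2 * b} := by simp [mul_comm]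
        _ ≤ (2 * b) ^ 2 * tail F b := by
          gcongr
          exact measureReal_mono fun x hx => hx.1
    have h2 : ∫ x in {x | b < |x|}, x ^ 2 ∂F = ∫ x in {x | b < |x| ∧ |x| ≤ 2 * b}, x ^ 2 ∂F
        + ∫ x in {x | 2 * b < |x|}, x ^ 2 ∂F := by
      have hdisj : Disjoint {x : ℝ | b < |x| ∧ |x| ≤ 2 * b} {x : ℝ | 2 * b < |x|} :=
        Set.disjoint_left.2 fun x hx hx' => absurd hx.2 (not_le.2 hx')
      rw [hsplit, setIntegral_union hdisj (measurableSet_lt_abs _)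
        hi.integrableOn hi.integrableOn]
    have h3 : C * (2 * b) ^ 2 * tail F (2 * b) ≤ C * (2 * b) ^ 2 * (r₂ * tail F b) := by
      gcongr
      exact (hd b hb).2
    have h4 : C * (2 * b) ^ 2 * (r₂ * tail F b) = (C - 4) * b ^ 2 * tail F b := by
      linear_combination (-(b ^ 2 * tail F b)) * hC1
    simp only [hD]
    rw [h2]
    linarith
  refine ⟨C, x₀, hC0, fun b hb => ?_⟩
  have hb0 : 0 < b := by linarith
  have hiter : ∀ n : ℕ, D b ≤ D (2 ^ n * b) := by
    intro n
    induction n with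
    | zero => simp
    | succ n ih =>
      refine ih.trans ((step _ ?_).trans_eq (by ring_nf))
      have : (1 : ℝ) ≤ 2 ^ n := one_le_pow₀ one_le_two
      nlinarith
  -- The defect `D` increases along `b, 2b, 4b, …` and is dominated by a tail of a convergent
  -- integral, so it is nonpositive.
  have hle : D b ≤ 0 := by
    refine ge_of_tendsto' (tendsto_setIntegral_lt_abs hi hb0) fun n => (hiter n).trans ?_
    simp only [hD]
    have := tail_nonneg (F := F) (2 ^ n * b)
    have : 0 ≤ C * (2 ^ n * b) ^ 2 * tail F (2 ^ n * b) := by positivity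
    linarith
  simp only [hD] at hle
  linarith

end RegularTail

/-! ### Convergence of the exponents -/

lemma hasDerivAt_exp_I_mul (t v : ℝ) :
    HasDerivAt (fun v : ℝ => Complex.exp (Complex.I * t * v))
      (Complex.I * t * Complex.exp (Complex.I * t * v)) v := by
  have h1 : HasDerivAt (fun v : ℝ => Complex.I * t * (v : ℂ)) (Complex.I * t) v := by
    simpa using (Complex.ofRealCLM.hasDerivAt (x := v)).const_mul (Complex.I * t)
  simpa [mul_comm] using h1.cexp

lemma norm_exp_I_mul (t v : ℝ) : ‖Complex.exp (Complex.I * t * v)‖ = 1 := by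
  rw [mul_assoc, ← Complex.ofReal_mul, Complex.norm_exp_I_mul_ofReal]

lemma norm_I_mul_exp (t v : ℝ) : ‖Complex.I * t * Complex.exp (Complex.I * t * v)‖ = |t| := by
  rw [norm_mul, norm_exp_I_mul]; simp

lemma setIntegral_Ioc_deriv_exp {ε M t : ℝ} (h : ε ≤ M) :
    ∫ v in Set.Ioc ε M, Complex.I * t * Complex.exp (Complex.I * t * v)
      = Complex.exp (Complex.I * t * M) - Complex.exp (Complex.I * t * ε) := by
  rw [← intervalIntegral.integral_of_le h]
  exact intervalIntegral.integral_eq_sub_of_hasDerivAt (fun v _ => hasDerivAt_exp_I_mul t v)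
    (Continuous.intervalIntegrable (by fun_prop) _ _)

section Truncation

variable {Ω : Type*} [MeasurableSpace Ω] {ρ : Measure Ω} {V : Ω → ℝ} {ε M : ℝ}

/-- Integration by parts (Fubini) for `v ↦ e^{itv}` between the levels `ε` and `M`. -/
lemma setIntegral_exp_mul_tail (hV : Measurable V) (hεM : ε ≤ M) (hfin : ρ {ω | ε < V ω} ≠ ⊤)
    (t : ℝ) :
    ∫ v in Set.Ioc ε M, Complex.I * t * Complex.exp (Complex.I * t * v) *
        (ρ.real {ω | v < V ω} : ℂ)
      = ∫ ω in {ω | ε < V ω}, (Complex.exp (Complex.I * t * (min (V ω) M : ℝ))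
          - Complex.exp (Complex.I * t * ε)) ∂ρ := by
  have hmε : MeasurableSet {ω | ε < V ω} := measurableSet_lt measurable_const hV
  have hlt : MeasurableSet {q : ℝ × Ω | q.1 < V q.2} :=
    measurableSet_lt measurable_fst (hV.comp measurable_snd)
  have : IsFiniteMeasure (ρ.restrict {ω | ε < V ω}) := ⟨by simpa using hfin.lt_top⟩
  set g : ℝ → ℂ := fun v => Complex.I * t * Complex.exp (Complex.I * t * v) with hg
  have hgm : Measurable g := by fun_prop
  have hint : Integrable (fun q : ℝ × Ω => {q : ℝ × Ω | q.1 < V q.2}.indicator (fun q => g q.1) q)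
      ((volume.restrict (Set.Ioc ε M)).prod (ρ.restrict {ω | ε < V ω})) := by
    refine Integrable.of_bound ?_ |t| (ae_of_all _ fun q => ?_)
    · exact ((hgm.comp measurable_fst).indicator hlt).aestronglyMeasurable
    · refine (norm_indicator_le_norm_self _ _).trans_eq ?_
      exact norm_I_mul_exp t q.1
  calc ∫ v in Set.Ioc ε M, g v * (ρ.real {ω | v < V ω} : ℂ)
      = ∫ v in Set.Ioc ε M, ∫ ω in {ω | ε < V ω},
          {q : ℝ × Ω | q.1 < V q.2}.indicator (fun q => g q.1) (v, ω) ∂ρ := by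
        refine setIntegral_congr_fun measurableSet_Ioc fun v hv => ?_
        have hm : MeasurableSet {ω | v < V ω} := measurableSet_lt measurable_const hV
        have he : (fun ω => {q : ℝ × Ω | q.1 < V q.2}.indicator (fun q => g q.1) (v, ω))
            = {ω | v < V ω}.indicator fun _ => g v := by
          ext ω
          simp only [Set.indicator_apply, Set.mem_ofPred_eq]
        have hs : {ω | v < V ω} ∩ {ω | ε < V ω} = {ω | v < V ω} :=
          Set.inter_eq_left.2 fun ω hω => lt_trans hv.1 hω
        simp only [he]
        rw [integral_indicator hm, Measure.restrict_restrict hm, hs, setIntegral_const,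
          Complex.real_smul, mul_comm]
    _ = ∫ ω in {ω | ε < V ω}, (∫ v in Set.Ioc ε M,
          {q : ℝ × Ω | q.1 < V q.2}.indicator (fun q => g q.1) (v, ω)) ∂ρ :=
        integral_integral_swap hint
    _ = _ := by
        refine setIntegral_congr_fun hmε fun ω hω => ?_
        have he : (fun v => {q : ℝ × Ω | q.1 < V q.2}.indicator (fun q => g q.1) (v, ω))
            = (Set.Iio (V ω)).indicator g := by
          ext v
          simp only [Set.indicator_apply, Set.mem_ofPred_eq, Set.mem_Iio]
        simp only [he]
        rw [integral_indicator measurableSet_Iio, Measure.restrict_restrict measurableSet_Iio,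
          ← setIntegral_Ioc_deriv_exp (le_min (le_of_lt hω) hεM)]
        have hs : Set.Iic (V ω) ∩ Set.Ioc ε M = Set.Ioc ε (min (V ω) M) := by
          ext v
          simp only [Set.mem_inter_iff, Set.mem_Iic, Set.mem_Ioc, le_min_iff]
          tauto
        rw [← hs]
        exact setIntegral_congr_set (Iio_ae_eq_Iic.inter (ae_eq_refl _))

/-- The three errors come from the part `V ≤ ε`, from replacing `1` by `e^{itε}` on `V > ε`, and
from capping `V` at `M`. Only the mass above `ε` must be finite, so the bound serves both the law
`F` and the infinite Lévy measure. -/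
lemma norm_integral_exp_sub_one_sub_le (hV : Measurable V) (hε : 0 ≤ ε) (hεM : ε ≤ M)
    (hfin : ρ {ω | ε < V ω} ≠ ⊤) (hint : IntegrableOn V {ω | V ω ≤ ε} ρ) (t : ℝ) :
    ‖∫ ω, (Complex.exp (Complex.I * t * V ω) - 1) ∂ρ -
        ∫ v in Set.Ioc ε M, Complex.I * t * Complex.exp (Complex.I * t * v) *
          (ρ.real {ω | v < V ω} : ℂ)‖
      ≤ |t| * ∫ ω in {ω | V ω ≤ ε}, |V ω| ∂ρ + |t| * ε * ρ.real {ω | ε < V ω}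
        + 2 * ρ.real {ω | M < V ω} := by
  have hmε : MeasurableSet {ω | ε < V ω} := measurableSet_lt measurable_const hV
  have hmε' : MeasurableSet {ω | V ω ≤ ε} := measurableSet_le hV measurable_const
  have hmM : MeasurableSet {ω | M < V ω} := measurableSet_lt measurable_const hV
  have : IsFiniteMeasure (ρ.restrict {ω | ε < V ω}) := ⟨by simpa using hfin.lt_top⟩
  have hc : {ω | ε < V ω}ᶜ = {ω | V ω ≤ ε} := by
    ext ω; simp
  have hi1 : IntegrableOn (fun ω => Complex.exp (Complex.I * t * V ω) - 1) {ω | V ω ≤ ε} ρ :=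
    Integrable.mono' (hint.abs.const_mul |t|) (by fun_prop)
      (ae_of_all _ fun ω => norm_exp_I_mul_sub_one_le t (V ω))
  have hi2 : IntegrableOn (fun ω => Complex.exp (Complex.I * t * V ω) - 1) {ω | ε < V ω} ρ :=
    Integrable.of_bound (by fun_prop) 2 (ae_of_all _ fun ω => norm_exp_I_mul_sub_one_le_two t _)
  have hi : Integrable (fun ω => Complex.exp (Complex.I * t * V ω) - 1) ρ := by
    rw [← integrableOn_univ, ← Set.union_compl_self {ω | ε < V ω}, hc]
    exact hi2.union hi1
  have hi3 : IntegrableOn (fun ω => Complex.exp (Complex.I * t * (min (V ω) M : ℝ))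
      - Complex.exp (Complex.I * t * ε)) {ω | ε < V ω} ρ := by
    refine Integrable.of_bound ?_ 2 (ae_of_all _ fun ω => ?_)
    · have : Measurable fun ω => min (V ω) M := hV.min measurable_const
      fun_prop
    · refine (norm_sub_le _ _).trans_eq ?_
      rw [norm_exp_I_mul, norm_exp_I_mul]; norm_num
  rw [setIntegral_exp_mul_tail hV hεM hfin, ← integral_add_compl hmε hi, hc, add_comm,
    add_sub_assoc, ← integral_sub hi2 hi3, add_assoc]
  refine (norm_add_le _ _).trans (add_le_add ?_ ?_)
  · rw [← integral_const_mul]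
    exact norm_integral_le_of_norm_le (hint.abs.const_mul |t|)
      (ae_of_all _ fun ω => norm_exp_I_mul_sub_one_le t (V ω))
  · have hb : ∀ ω, ‖Complex.exp (Complex.I * t * V ω) - 1 -
        (Complex.exp (Complex.I * t * (min (V ω) M : ℝ)) - Complex.exp (Complex.I * t * ε))‖
        ≤ |t| * ε + {ω | M < V ω}.indicator (fun _ => (2 : ℝ)) ω := by
      intro ω
      have h1 : ‖Complex.exp (Complex.I * t * ε) - 1‖ ≤ |t| * ε := by
        simpa [abs_of_nonneg hε] using norm_exp_I_mul_sub_one_le t ε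
      have h2 : ‖Complex.exp (Complex.I * t * V ω) -
          Complex.exp (Complex.I * t * (min (V ω) M : ℝ))‖
          ≤ {ω | M < V ω}.indicator (fun _ => (2 : ℝ)) ω := by
        by_cases hω : M < V ω
        · rw [Set.indicator_of_mem (show ω ∈ {ω | M < V ω} from hω)]
          refine (norm_sub_le _ _).trans_eq ?_
          rw [norm_exp_I_mul, norm_exp_I_mul]; norm_num
        · rw [Set.indicator_of_notMem (show ω ∉ {ω | M < V ω} from hω),
            min_eq_left (not_lt.1 hω), sub_self, norm_zero]
      calc _ = ‖(Complex.exp (Complex.I * t * ε) - 1) + (Complex.exp (Complex.I * t * V ω) -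
          Complex.exp (Complex.I * t * (min (V ω) M : ℝ)))‖ := by congr 1; ring
        _ ≤ _ := (norm_add_le _ _).trans (add_le_add h1 h2)
    have hi4 : Integrable ({ω | M < V ω}.indicator (fun _ => (2 : ℝ)))
        (ρ.restrict {ω | ε < V ω}) := (integrable_const _).indicator hmM
    refine (norm_integral_le_of_norm_le ((integrable_const _).add hi4)
      (ae_of_all _ hb)).trans_eq ?_
    have hs : {ω | M < V ω} ∩ {ω | ε < V ω} = {ω | M < V ω} :=
      Set.inter_eq_left.2 fun ω hω => lt_of_le_of_lt hεM hω
    rw [integral_add' (integrable_const _) hi4, integral_indicator hmM,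
      Measure.restrict_restrict hmM, hs]
    simp [mul_comm]

end Truncation

/-! ### The Lévy measure of the limit law -/

section LevyMeasure

/-- The Lévy measure `β x^{-(β + 1)} dx` on `(0, ∞)`. -/
noncomputable def stableLevyMeasure (β : ℝ) : Measure ℝ :=
  (volume.restrict (Set.Ioi 0)).withDensity fun x => ENNReal.ofReal (β * x ^ (-(β + 1)))

variable {β : ℝ}

lemma stableLevyMeasure_Ioi (hβ : 0 < β) {v : ℝ} (hv : 0 < v) :
    stableLevyMeasure β (Set.Ioi v) = ENNReal.ofReal (v ^ (-β)) := by
  have hs : Set.Ioi v ∩ Set.Ioi 0 = Set.Ioi v :=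
    Set.inter_eq_left.2 (Set.Ioi_subset_Ioi hv.le)
  rw [stableLevyMeasure, withDensity_apply _ measurableSet_Ioi,
    Measure.restrict_restrict measurableSet_Ioi, hs, ← ofReal_integral_eq_lintegral_ofReal]
  · rw [integral_const_mul, integral_Ioi_rpow_of_lt (by linarith) hv,
      show -(β + 1) + 1 = -β by ring]
    field_simp
  · exact (integrableOn_Ioi_rpow_of_lt (by linarith) hv).const_mul β
  · refine (ae_restrict_iff' measurableSet_Ioi).2 (ae_of_all _ fun x hx => ?_)
    exact mul_nonneg hβ.le (Real.rpow_nonneg (hv.le.trans (le_of_lt hx)) _)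

lemma stableLevyMeasure_real_lt (hβ : 0 < β) {v : ℝ} (hv : 0 < v) :
    (stableLevyMeasure β).real {x | v < x} = v ^ (-β) := by
  change (stableLevyMeasure β (Set.Ioi v)).toReal = _
  rw [stableLevyMeasure_Ioi hβ hv, ENNReal.toReal_ofReal (Real.rpow_nonneg hv.le _)]

lemma integral_stableLevyMeasure {E : Type*} [NormedAddCommGroup E] [NormedSpace ℝ E]
    (hβ : 0 < β) (s : Set ℝ) (hs : MeasurableSet s) (f : ℝ → E) :
    ∫ x in s, f x ∂(stableLevyMeasure β)
      = ∫ x in s ∩ Set.Ioi 0, (β * x ^ (-(β + 1))) • f x := by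
  rw [stableLevyMeasure, restrict_withDensity hs, integral_withDensity_eq_integral_toReal_smul
    (by fun_prop) (ae_of_all _ fun x => ENNReal.ofReal_lt_top), Measure.restrict_restrict hs]
  refine setIntegral_congr_fun (hs.inter measurableSet_Ioi) fun x hx => ?_
  have : 0 ≤ β * x ^ (-(β + 1)) := mul_nonneg hβ.le (Real.rpow_nonneg (le_of_lt hx.2) _)
  simp only [ENNReal.toReal_ofReal this]

lemma mul_stableExponent_eq_integral (hβ : 0 < β) (t : ℝ) :
    β * stableExponent β t
      = ∫ x : ℝ, (Complex.exp (Complex.I * t * x) - 1) ∂(stableLevyMeasure β) := by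
  rw [← setIntegral_univ, integral_stableLevyMeasure hβ _ MeasurableSet.univ, Set.univ_inter,
    stableExponent, ← integral_const_mul]
  congr 1
  ext x
  rw [Complex.real_smul]
  push_cast
  ring

lemma mul_rpow_neg_add_one (hβ : 0 < β) {x : ℝ} (hx : 0 ≤ x) :
    x * x ^ (-(β + 1)) = x ^ (-β) := by
  rw [← Real.rpow_one_add' hx (by simpa using hβ.ne')]; ring_nf

lemma Iic_inter_Ioi_zero (ε : ℝ) : {x : ℝ | x ≤ ε} ∩ Set.Ioi 0 = Set.Ioc 0 ε := by
  ext x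
  simp [and_comm]

lemma integrableOn_stableLevyMeasure (hβ : 0 < β) (hβ' : β < 1) {ε : ℝ} (hε : 0 < ε) :
    IntegrableOn (fun x : ℝ => x) {x | x ≤ ε} (stableLevyMeasure β) := by
  have hm : MeasurableSet {x : ℝ | x ≤ ε} := measurableSet_Iic
  rw [IntegrableOn, stableLevyMeasure, restrict_withDensity hm,
    integrable_withDensity_iff_integrable_smul' (by fun_prop)
      (ae_of_all _ fun x => ENNReal.ofReal_lt_top), Measure.restrict_restrict hm,
    Iic_inter_Ioi_zero]
  have h1 : IntegrableOn (fun x : ℝ => β * x ^ (-β)) (Set.Ioc 0 ε) := by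
    have := (intervalIntegral.intervalIntegrable_rpow' (a := 0) (b := ε)
      (r := -β) (by linarith)).const_mul β
    rwa [intervalIntegrable_iff_integrableOn_Ioc_of_le hε.le] at this
  refine IntegrableOn.congr_fun h1 (fun x hx => ?_) measurableSet_Ioc
  have : 0 ≤ β * x ^ (-(β + 1)) := mul_nonneg hβ.le (Real.rpow_nonneg hx.1.le _)
  rw [ENNReal.toReal_ofReal this, ← mul_rpow_neg_add_one hβ hx.1.le, smul_eq_mul]
  ring

lemma integral_abs_stableLevyMeasure (hβ : 0 < β) (hβ' : β < 1) {ε : ℝ} (hε : 0 < ε) :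
    ∫ x in {x | x ≤ ε}, |x| ∂(stableLevyMeasure β) = β / (1 - β) * ε ^ (1 - β) := by
  have hm : MeasurableSet {x : ℝ | x ≤ ε} := measurableSet_Iic
  rw [integral_stableLevyMeasure hβ _ hm, Iic_inter_Ioi_zero]
  have : ∫ x in Set.Ioc 0 ε, (β * x ^ (-(β + 1))) • |x| = ∫ x in Set.Ioc 0 ε, β * x ^ (-β) := by
    refine setIntegral_congr_fun measurableSet_Ioc fun x hx => ?_
    rw [← mul_rpow_neg_add_one hβ hx.1.le, smul_eq_mul, abs_of_pos hx.1]
    ring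
  rw [this, integral_const_mul, ← intervalIntegral.integral_of_le hε.le,
    integral_rpow (Or.inl (by linarith)), show -β + 1 = 1 - β by ring,
    Real.zero_rpow (by linarith)]
  field_simp
  ring

lemma norm_mul_stableExponent_sub_le (hβ : 0 < β) (hβ' : β < 1) {ε M : ℝ} (hε : 0 < ε)
    (hεM : ε ≤ M) (t : ℝ) :
    ‖β * stableExponent β t - ∫ v in Set.Ioc ε M,
        Complex.I * t * Complex.exp (Complex.I * t * v) * ((v ^ (-β) : ℝ) : ℂ)‖
      ≤ |t| * (β / (1 - β) + 1) * ε ^ (1 - β) + 2 * M ^ (-β) := by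
  have h := norm_integral_exp_sub_one_sub_le (ρ := stableLevyMeasure β) (V := fun x : ℝ => x)
    measurable_id hε.le hεM
    ((stableLevyMeasure_Ioi hβ hε).trans_ne ENNReal.ofReal_ne_top)
    (integrableOn_stableLevyMeasure hβ hβ' hε) t
  rw [← mul_stableExponent_eq_integral hβ, integral_abs_stableLevyMeasure hβ hβ' hε,
    stableLevyMeasure_real_lt hβ hε, stableLevyMeasure_real_lt hβ (hε.trans_le hεM)] at h
  have h1 : ∫ v in Set.Ioc ε M, Complex.I * t * Complex.exp (Complex.I * t * v) *
      (((stableLevyMeasure β).real {x | v < x} : ℝ) : ℂ) = ∫ v in Set.Ioc ε M,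
        Complex.I * t * Complex.exp (Complex.I * t * v) * ((v ^ (-β) : ℝ) : ℂ) := by
    refine setIntegral_congr_fun measurableSet_Ioc fun v hv => ?_
    rw [stableLevyMeasure_real_lt hβ (hε.trans hv.1)]
  rw [h1] at h
  refine h.trans_eq ?_
  have : ε * ε ^ (-β) = ε ^ (1 - β) := by
    rw [← Real.rpow_one_add' hε.le (by linarith)]; ring_nf
  rw [mul_assoc |t| ε, this]
  ring

end LevyMeasure

lemma tendsto_of_forall_approx {u : ℕ → ℂ} {l : ℂ}
    (H : ∀ η : ℝ, 0 < η → ∃ (u' : ℕ → ℂ) (l' : ℂ), Tendsto u' atTop (𝓝 l') ∧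
      (∀ᶠ k in atTop, ‖u k - u' k‖ ≤ η) ∧ ‖l - l'‖ ≤ η) : Tendsto u atTop (𝓝 l) := by
  refine Metric.tendsto_nhds.2 fun η hη => ?_
  obtain ⟨u', l', h1, h2, h3⟩ := H (η / 4) (by positivity)
  filter_upwards [Metric.tendsto_nhds.1 h1 (η / 4) (by positivity), h2] with k hk hk'
  rw [dist_eq_norm] at hk ⊢
  calc ‖u k - l‖ = ‖(u k - u' k) + (u' k - l') - (l - l')‖ := by congr 1; ring
    _ ≤ ‖u k - u' k‖ + ‖u' k - l'‖ + ‖l - l'‖ :=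
      (norm_sub_le _ _).trans (by gcongr; exact norm_add_le _ _)
    _ < η := by linarith

/-- Monotonicity of `T k` bounds it on `(ε, M]` by its convergent value at `ε`, so pointwise
convergence suffices. -/
lemma tendsto_setIntegral_exp_mul {T : ℕ → ℝ → ℝ} {τ : ℝ → ℝ} {ε M : ℝ}
    (hT : ∀ k, Antitone (T k)) (hT0 : ∀ k v, 0 ≤ T k v)
    (hlim : ∀ v, ε ≤ v → Tendsto (fun k => T k v) atTop (𝓝 (τ v))) (t : ℝ) :
    Tendsto (fun k => ∫ v in Set.Ioc ε M,
        Complex.I * t * Complex.exp (Complex.I * t * v) * (T k v : ℂ)) atTop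
      (𝓝 (∫ v in Set.Ioc ε M,
        Complex.I * t * Complex.exp (Complex.I * t * v) * (τ v : ℂ))) := by
  refine tendsto_integral_filter_of_dominated_convergence (fun _ => |t| * (τ ε + 1)) ?_ ?_
    (integrable_const _) ?_
  · refine Eventually.of_forall fun k => ?_
    have := (hT k).measurable
    exact Measurable.aestronglyMeasurable (by fun_prop)
  · filter_upwards [(hlim ε le_rfl).eventually_le_const (lt_add_one _)] with k hk
    refine (ae_restrict_iff' measurableSet_Ioc).2 (ae_of_all _ fun v hv => ?_)
    rw [norm_mul, norm_I_mul_exp, Complex.norm_real, Real.norm_of_nonneg (hT0 k v)]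
    exact mul_le_mul_of_nonneg_left ((hT k hv.1.le).trans hk) (abs_nonneg t)
  · refine (ae_restrict_iff' measurableSet_Ioc).2 (ae_of_all _ fun v hv => ?_)
    exact ((Complex.continuous_ofReal.tendsto _).comp (hlim v hv.1.le)).const_mul _

namespace RegularTail

variable {F : Measure ℝ} [IsProbabilityMeasure F] {α : ℝ}

lemma setOf_lt_pow_four_div {a v : ℝ} (ha : 0 < a) (hv : 0 ≤ v) :
    {x : ℝ | v < x ^ 4 / a ^ 4} = {x : ℝ | v ^ (1 / 4 : ℝ) * a < |x|} := by
  have hv4 : (v ^ (1 / 4 : ℝ)) ^ 4 = v := by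
    rw [← Real.rpow_natCast, ← Real.rpow_mul hv]; norm_num
  have hv0 : 0 ≤ v ^ (1 / 4 : ℝ) := Real.rpow_nonneg hv _
  ext x
  simp only [Set.mem_ofPred_eq]
  rw [lt_div_iff₀ (by positivity), ← Even.pow_abs (by decide : Even 4) x]
  nth_rw 1 [← hv4]
  rw [← mul_pow, pow_lt_pow_iff_left₀ (by positivity) (abs_nonneg _) (by norm_num)]

lemma setOf_pow_four_div_le {a v : ℝ} (ha : 0 < a) (hv : 0 ≤ v) :
    {x : ℝ | x ^ 4 / a ^ 4 ≤ v} = {x : ℝ | |x| ≤ v ^ (1 / 4 : ℝ) * a} := by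
  have h := congrArg compl (setOf_lt_pow_four_div ha hv)
  ext x
  have := Set.ext_iff.1 h x
  simpa only [Set.mem_compl_iff, Set.mem_ofPred_eq, not_lt] using this

/-- The exponents of the triangular array `X⁴ / a_k⁴` converge. -/
lemma tendsto_mul_integral_exp_sub_one (h : RegularTail F α) (hα : 2 < α) (hα' : α < 4) (t : ℝ) :
    Tendsto (fun k : ℕ => (k : ℂ) * ∫ x : ℝ, (Complex.exp (Complex.I * t *
        ((x ^ 4 / tailQuantile F k ^ 4 : ℝ) : ℂ)) - 1) ∂F) atTop
      (𝓝 (((α / 4 : ℝ) : ℂ) * stableExponent (α / 4) t)) := by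
  set β := α / 4 with hβdef
  have hβ : 0 < β := by linarith
  have hβ' : β < 1 := by linarith
  obtain ⟨C, x₀, hC0, hC⟩ := h.exists_integral_pow_four_le hα hα'
  have ha := h.tendsto_tailQuantile
  let V : ℕ → ℝ → ℝ := fun k x => x ^ 4 / tailQuantile F k ^ 4
  let T : ℕ → ℝ → ℝ := fun k v => k * F.real {x | v < V k x}
  have hT : ∀ k, Antitone (T k) := fun k v w hvw =>
    mul_le_mul_of_nonneg_left (measureReal_mono fun x hx => lt_of_le_of_lt hvw hx)
      (Nat.cast_nonneg _)
  have hT0 : ∀ k v, 0 ≤ T k v := fun k v => by positivity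
  have hlim : ∀ v, 0 < v → Tendsto (fun k => T k v) atTop (𝓝 (v ^ (-β))) := by
    intro v hv
    have h1 := h.tendsto_mul_tail_mul_tailQuantile (Real.rpow_pos_of_pos hv (1 / 4))
    rw [← Real.rpow_mul hv.le, show 1 / 4 * -α = -β by rw [hβdef]; ring] at h1
    refine h1.congr' ?_
    filter_upwards [ha.eventually_gt_atTop 0] with k hk
    simp only [T, V, setOf_lt_pow_four_div hk hv.le, tail]
  refine tendsto_of_forall_approx fun η hη => ?_
  -- One `ε` serves both approximations: `C` is Karamata's constant for `F`, and `β / (1 - β)` is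
  -- its counterpart for the Lévy measure.
  have hε : ∀ᶠ ε : ℝ in 𝓝[>] 0, |t| * (C + β / (1 - β) + 1) * ε ^ (1 - β) < η / 2 := by
    have h1 : Tendsto (fun ε : ℝ => |t| * (C + β / (1 - β) + 1) * ε ^ (1 - β)) (𝓝 0) (𝓝 0) := by
      have : ContinuousAt (fun ε : ℝ => |t| * (C + β / (1 - β) + 1) * ε ^ (1 - β)) 0 :=
        continuousAt_const.mul (Real.continuousAt_rpow_const _ _ (Or.inr (by linarith)))
      simpa [ContinuousAt, Real.zero_rpow (by linarith : (1 - β) ≠ 0)] using this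
    exact (h1.mono_left nhdsWithin_le_nhds).eventually_lt_const (by positivity)
  obtain ⟨ε, hε1, hε0⟩ := (hε.and self_mem_nhdsWithin).exists
  have hε0 : 0 < ε := hε0
  have hM : ∀ᶠ M : ℝ in atTop, 2 * M ^ (-β) < η / 2 := by
    have h1 := (tendsto_rpow_neg_atTop hβ).const_mul 2
    rw [mul_zero] at h1
    exact h1.eventually_lt_const (by positivity)
  obtain ⟨M, hM1, hM0⟩ := (hM.and (eventually_ge_atTop ε)).exists
  have hεpow : ε * ε ^ (-β) = ε ^ (1 - β) := by
    rw [← Real.rpow_one_add' hε0.le (by linarith)]; ring_nf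
  have hβ1 : 0 ≤ β / (1 - β) := div_nonneg hβ.le (by linarith)
  have hp : 0 ≤ ε ^ (1 - β) := Real.rpow_nonneg hε0.le _
  refine ⟨_, _, tendsto_setIntegral_exp_mul (ε := ε) (M := M) (τ := fun v => v ^ (-β)) hT hT0
    (fun v hv => hlim v (hε0.trans_le hv)) t, ?_,
    (norm_mul_stableExponent_sub_le hβ hβ' hε0 hM0 t).trans ?_⟩
  · have hB : Tendsto (fun k => |t| * (C + 1) * ε * T k ε + 2 * T k M) atTop
        (𝓝 (|t| * (C + 1) * ε * ε ^ (-β) + 2 * M ^ (-β))) :=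
      ((hlim ε hε0).const_mul _).add ((hlim M (hε0.trans_le hM0)).const_mul _)
    have hlt : |t| * (C + 1) * ε * ε ^ (-β) + 2 * M ^ (-β) < η := by
      rw [mul_assoc _ ε, hεpow]
      have : |t| * (C + 1) * ε ^ (1 - β) ≤ |t| * (C + β / (1 - β) + 1) * ε ^ (1 - β) := by
        gcongr
        linarith
      linarith
    filter_upwards [hB.eventually_le_const hlt, ha.eventually_gt_atTop 0,
      (ha.const_mul_atTop (Real.rpow_pos_of_pos hε0 (1 / 4))).eventually_ge_atTop x₀]
      with k hk hak hak'
    refine le_trans ?_ hk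
    have hVm : Measurable (V k) := by fun_prop
    have hset := setOf_pow_four_div_le hak hε0.le
    have hiV : IntegrableOn (V k) {x | V k x ≤ ε} F := by
      have := (integrableOn_pow_four F (ε ^ (1 / 4 : ℝ) * tailQuantile F k)).div_const
        (tailQuantile F k ^ 4)
      rw [← hset] at this
      exact this
    have hmain := norm_integral_exp_sub_one_sub_le (ρ := F) hVm hε0.le hM0 (measure_ne_top _ _)
      hiV t
    have hJ : ∫ x in {x | V k x ≤ ε}, |V k x| ∂F ≤ C * ε * F.real {x | ε < V k x} := by
      have h1 := hC _ hak'
      have h2 : ∫ x in {x | V k x ≤ ε}, |V k x| ∂F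
          = (∫ x in {x | |x| ≤ ε ^ (1 / 4 : ℝ) * tailQuantile F k}, x ^ 4 ∂F)
            / tailQuantile F k ^ 4 := by
        rw [← hset, ← integral_div]
        congr 1
        ext x
        exact abs_of_nonneg (by positivity)
      have h3 : (ε ^ (1 / 4 : ℝ)) ^ 4 = ε := by
        rw [← Real.rpow_natCast, ← Real.rpow_mul hε0.le]; norm_num
      rw [h2, div_le_iff₀ (by positivity)]
      refine h1.trans_eq ?_
      rw [mul_pow, h3, show F.real {x | ε < V k x} = tail F (ε ^ (1 / 4 : ℝ) * tailQuantile F k) by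
        rw [tail, ← setOf_lt_pow_four_div hak hε0.le]]
      ring
    have hscale : ∫ v in Set.Ioc ε M, Complex.I * t * Complex.exp (Complex.I * t * v) *
        (T k v : ℂ) = k * ∫ v in Set.Ioc ε M, Complex.I * t * Complex.exp (Complex.I * t * v) *
        (F.real {x | v < V k x} : ℂ) := by
      rw [← integral_const_mul]
      congr 1
      ext v
      simp only [T]
      push_cast
      ring
    rw [hscale, ← mul_sub, norm_mul, Complex.norm_natCast]
    calc _ ≤ (k : ℝ) * (|t| * (C * ε * F.real {x | ε < V k x})
          + |t| * ε * F.real {x | ε < V k x} + 2 * F.real {x | M < V k x}) := by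
          gcongr
          exact hmain.trans (by gcongr)
      _ = _ := by simp only [T]; ring
  · have : |t| * (β / (1 - β) + 1) * ε ^ (1 - β)
        ≤ |t| * (C + β / (1 - β) + 1) * ε ^ (1 - β) := by
      gcongr
      linarith
    linarith

end RegularTail

/-! ### Second moments of homogeneous polynomials in independent centred variables -/

/-- Independent, square integrable, centred random variables with common variance `s`. -/
structure IndepCentered {ι Ω : Type*} [MeasurableSpace Ω] (ξ : ι → Ω → ℝ) (s : ℝ)
    (P : Measure Ω) : Prop where
  indep : iIndepFun ξ P
  memLp : ∀ k, MemLp (ξ k) 2 P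
  mean : ∀ k, ∫ ω, ξ k ω ∂P = 0
  var : ∀ k, ∫ ω, ξ k ω ^ 2 ∂P = s

lemma integral_abs_le_sqrt {Ω : Type*} [MeasurableSpace Ω] {P : Measure Ω}
    [IsProbabilityMeasure P] {Z : Ω → ℝ} (hZ : MemLp Z 2 P) :
    ∫ ω, |Z ω| ∂P ≤ √(∫ ω, Z ω ^ 2 ∂P) := by
  refine Real.le_sqrt_of_sq_le ?_
  have h := variance_nonneg |Z| P
  rw [variance_eq_sub hZ.abs] at h
  simp only [Pi.pow_apply, Pi.abs_apply, sq_abs] at h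
  linarith

section Chaos

variable {ι Ω : Type*} [Fintype ι] [MeasurableSpace Ω] {P : Measure Ω}
  {ξ : ι → Ω → ℝ} {s : ℝ}

namespace IndepCentered

lemma integrable_prod (h : IndepCentered ξ s P) {f : ι → ℝ → ℝ} (hf : ∀ k, Measurable (f k))
    (hfi : ∀ k, Integrable (fun ω => f k (ξ k ω)) P) :
    Integrable (fun ω => ∏ k, f k (ξ k ω)) P := by
  have := h.indep.isProbabilityMeasure
  have hm : ∀ k, AEMeasurable (ξ k) P := fun k => (h.memLp k).aemeasurable
  have hp : ∀ k, IsProbabilityMeasure (P.map (ξ k)) := fun k =>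
    Measure.isProbabilityMeasure_map (hm k)
  have h1 : Integrable (fun x : ι → ℝ => ∏ k, f k (x k)) (P.map fun ω k => ξ k ω) := by
    rw [h.indep.map_fun_eq_pi_map hm]
    exact Integrable.fintype_prod fun k =>
      (integrable_map_measure (hf k).aestronglyMeasurable (hm k)).2 (hfi k)
  exact h1.comp_aemeasurable (aemeasurable_pi_lambda _ hm)

variable [DecidableEq ι]

lemma memLp_prod (h : IndepCentered ξ s P) (A : Finset ι) :
    MemLp (fun ω => ∏ k ∈ A, ξ k ω) 2 P := by
  have := h.indep.isProbabilityMeasure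
  have hm : AEStronglyMeasurable (fun ω => ∏ k ∈ A, ξ k ω) P :=
    Finset.aestronglyMeasurable_fun_prod A fun k _ => (h.memLp k).aestronglyMeasurable
  rw [memLp_two_iff_integrable_sq hm]
  have h1 := h.integrable_prod (f := fun k x => if k ∈ A then x ^ 2 else 1) (fun k => by
    split_ifs <;> fun_prop) (fun k => by
    split_ifs
    · exact (h.memLp k).integrable_sq
    · exact integrable_const _)
  refine h1.congr (ae_of_all _ fun ω => ?_)
  simp only
  rw [← Finset.prod_pow, Finset.prod_ite_mem, Finset.univ_inter]

/-- Orthogonality: if `A ≠ B`, some variable occurs exactly once in the product and its zero mean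
kills the integral. -/
lemma integral_prod_mul_prod (h : IndepCentered ξ s P) (A B : Finset ι) :
    ∫ ω, (∏ k ∈ A, ξ k ω) * ∏ k ∈ B, ξ k ω ∂P = if A = B then s ^ A.card else 0 := by
  have := h.indep.isProbabilityMeasure
  have h1 : ∀ ω, (∏ k ∈ A, ξ k ω) * ∏ k ∈ B, ξ k ω
      = ∏ k, (fun k x => (if k ∈ A then x else 1) * (if k ∈ B then x else (1 : ℝ))) k (ξ k ω) := by
    intro ω
    simp only
    rw [Finset.prod_mul_distrib, Finset.prod_ite_mem, Finset.prod_ite_mem, Finset.univ_inter,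
      Finset.univ_inter]
  rw [integral_congr_ae (ae_of_all _ h1), h.indep.integral_fun_prod_comp
    (f := fun k x => (if k ∈ A then x else 1) * (if k ∈ B then x else (1 : ℝ)))
    (fun k => (h.memLp k).aemeasurable)
    (fun k => Measurable.aestronglyMeasurable (by split_ifs <;> fun_prop))]
  split_ifs with hAB
  · subst hAB
    have h2 : ∀ k, ∫ ω, (if k ∈ A then ξ k ω else 1) * (if k ∈ A then ξ k ω else (1 : ℝ)) ∂P
        = if k ∈ A then s else 1 := by
      intro k
      split_ifs
      · rw [← h.var k]; simp only [sq]
      · simp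
    simp only [h2]
    rw [Finset.prod_ite_mem, Finset.univ_inter, Finset.prod_const]
  · obtain ⟨k, hk⟩ : ∃ k, ¬(k ∈ A ↔ k ∈ B) := by
      by_contra! hc
      exact hAB (Finset.ext hc)
    refine Finset.prod_eq_zero (Finset.mem_univ k) ?_
    by_cases hA : k ∈ A <;> by_cases hB : k ∈ B <;> simp_all [h.mean k]

variable {κ : Type*} (I : Finset κ) (A : κ → Finset ι)

lemma memLp_sum_prod (h : IndepCentered ξ s P) :
    MemLp (fun ω => ∑ e ∈ I, ∏ k ∈ A e, ξ k ω) 2 P :=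
  memLp_finsetSum I fun e _ => h.memLp_prod (A e)

/-- Each monomial `∏ k ∈ A e, ξ k` is determined up to a factor `d ^ 2`. -/
lemma integral_sq_sum_prod_le (h : IndepCentered ξ s P) {d : ℕ} (hA : ∀ e ∈ I, (A e).card = d)
    {f g : κ → ι} (hf : ∀ e ∈ I, f e ∈ A e) (hg : ∀ e ∈ I, g e ∈ A e)
    (hfg : ∀ e ∈ I, ∀ e' ∈ I, f e = f e' → g e = g e' → e = e') (hs : 0 ≤ s) :
    ∫ ω, (∑ e ∈ I, ∏ k ∈ A e, ξ k ω) ^ 2 ∂P ≤ d ^ 2 * I.card * s ^ d := by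
  have hint : ∀ e e', Integrable (fun ω => (∏ k ∈ A e, ξ k ω) * ∏ k ∈ A e', ξ k ω) P :=
    fun e e' => (h.memLp_prod (A e)).integrable_mul (h.memLp_prod (A e'))
  simp_rw [sq, Finset.sum_mul_sum]
  rw [integral_finsetSum _ fun e _ => integrable_finsetSum _ fun e' _ => hint e e']
  have h1 : ∀ e ∈ I, ∫ ω, ∑ e' ∈ I, (∏ k ∈ A e, ξ k ω) * ∏ k ∈ A e', ξ k ω ∂P
      ≤ d * d * s ^ d := by
    intro e he
    rw [integral_finsetSum _ fun e' _ => hint e e']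
    simp_rw [h.integral_prod_mul_prod]
    rw [← Finset.sum_filter, Finset.sum_const, hA e he, nsmul_eq_mul]
    refine mul_le_mul_of_nonneg_right ?_ (pow_nonneg hs d)
    -- The index `e'` is recovered from `(f e', g e')`, a pair of elements of `A e`; hence at most
    -- `d ^ 2` indices give the same monomial.
    have hc : (I.filter fun e' => A e = A e').card ≤ (A e ×ˢ A e).card := by
      refine Finset.card_le_card_of_injOn (fun e' => (f e', g e')) (fun e' he' => ?_) ?_
      · rw [Finset.mem_coe, Finset.mem_filter] at he'
        rw [Finset.mem_coe, Finset.mem_product, he'.2]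
        exact ⟨hf e' he'.1, hg e' he'.1⟩
      · intro e₁ he₁ e₂ he₂ hee
        rw [Finset.mem_coe, Finset.mem_filter] at he₁ he₂
        exact hfg e₁ he₁.1 e₂ he₂.1 (congrArg Prod.fst hee) (congrArg Prod.snd hee)
    rw [Finset.card_product, hA e he] at hc
    exact_mod_cast hc
  refine (Finset.sum_le_sum h1).trans_eq ?_
  rw [Finset.sum_const, nsmul_eq_mul]
  ring

end IndepCentered

end Chaos

/-! ### The quadratic and quartic forms in the expansion of the trace -/

section Forms

variable {m n : Type*} [Fintype m] [Fintype n]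

/-- `∑ᵢ ∑_{s ≠ t} y_{is} y_{it}`. -/
def rowForm (y : m → n → ℝ) : ℝ := ∑ i, ((∑ t, y i t) ^ 2 - ∑ t, y i t ^ 2)

/-- `∑_{i ≠ j} ∑_{s ≠ t} x_{is} x_{it} x_{js} x_{jt}`. -/
def rectForm (x : m → n → ℝ) : ℝ :=
  ∑ i, ∑ j, (∑ t, x i t * x j t) ^ 2 - ∑ i, (∑ t, x i t ^ 2) ^ 2 - ∑ t, (∑ i, x i t ^ 2) ^ 2
    + ∑ i, ∑ t, x i t ^ 4

/-- Serves twice: to centre the truncated entries, and with `c = -1` to pass from `x²` to `x² - 1`.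
-/
lemma rowForm_add_const (y : m → n → ℝ) (c : ℝ) :
    rowForm (fun i t => y i t + c) = rowForm y
      + 2 * c * ((Fintype.card n : ℝ) - 1) * ∑ k : m × n, y k.1 k.2
      + c ^ 2 * (Fintype.card m * (Fintype.card n * ((Fintype.card n : ℝ) - 1))) := by
  have h1 : ∀ i, (∑ t, (y i t + c)) ^ 2 - ∑ t, (y i t + c) ^ 2
      = ((∑ t, y i t) ^ 2 - ∑ t, y i t ^ 2) + 2 * c * ((Fintype.card n : ℝ) - 1) * ∑ t, y i t
        + c ^ 2 * (Fintype.card n * ((Fintype.card n : ℝ) - 1)) := by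
    intro i
    have h2 : ∑ t, (y i t + c) ^ 2 = ∑ t, y i t ^ 2 + 2 * c * ∑ t, y i t
        + Fintype.card n * c ^ 2 := by
      simp only [add_sq, Finset.sum_add_distrib, Finset.mul_sum, Finset.sum_const,
        Finset.card_univ, nsmul_eq_mul]
      congr 2
      exact Finset.sum_congr rfl fun t _ => by ring
    rw [h2, Finset.sum_add_distrib, Finset.sum_const, Finset.card_univ, nsmul_eq_mul]
    ring
  rw [rowForm, Finset.sum_congr rfl fun i _ => h1 i, rowForm, Finset.sum_add_distrib,
    Finset.sum_add_distrib, ← Finset.mul_sum, Finset.sum_const, Finset.card_univ, nsmul_eq_mul,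
    Fintype.sum_prod_type]
  ring

variable [DecidableEq m] [DecidableEq n]

lemma rowForm_eq_sum (y : m → n → ℝ) :
    rowForm y = ∑ e ∈ (Finset.univ : Finset (m × n × n)).filter (fun e => e.2.1 ≠ e.2.2),
      ∏ k ∈ {(e.1, e.2.1), (e.1, e.2.2)}, y k.1 k.2 := by
  have h1 : ∀ e ∈ (Finset.univ : Finset (m × n × n)).filter (fun e => e.2.1 ≠ e.2.2),
      ∏ k ∈ ({(e.1, e.2.1), (e.1, e.2.2)} : Finset (m × n)), y k.1 k.2
        = y e.1 e.2.1 * y e.1 e.2.2 := by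
    intro e he
    rw [Finset.mem_filter] at he
    rw [Finset.prod_pair (by simpa using he.2)]
  rw [Finset.sum_congr rfl h1, Finset.sum_filter, Fintype.sum_prod_type, rowForm]
  refine Finset.sum_congr rfl fun i _ => ?_
  rw [Fintype.sum_prod_type, sq, Finset.sum_mul_sum, ← Finset.sum_sub_distrib]
  refine Finset.sum_congr rfl fun a _ => ?_
  rw [sub_eq_iff_eq_add]
  have h2 : ∀ b, y i a * y i b
      = (if a ≠ b then y i a * y i b else 0) + if a = b then y i a * y i b else 0 := by
    intro b
    by_cases hab : a = b <;> simp [hab]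
  rw [Finset.sum_congr rfl fun b _ => h2 b, Finset.sum_add_distrib, Finset.sum_ite_eq]
  simp [sq]

lemma rectForm_eq_sum (x : m → n → ℝ) :
    rectForm x = ∑ e ∈ (Finset.univ : Finset ((m × m) × n × n)).filter
        (fun e => e.1.1 ≠ e.1.2 ∧ e.2.1 ≠ e.2.2),
      ∏ k ∈ {(e.1.1, e.2.1), (e.1.1, e.2.2), (e.1.2, e.2.1), (e.1.2, e.2.2)}, x k.1 k.2 := by
  have h1 : ∀ e ∈ (Finset.univ : Finset ((m × m) × n × n)).filter
        (fun e => e.1.1 ≠ e.1.2 ∧ e.2.1 ≠ e.2.2),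
      ∏ k ∈ ({(e.1.1, e.2.1), (e.1.1, e.2.2), (e.1.2, e.2.1), (e.1.2, e.2.2)} : Finset (m × n)),
        x k.1 k.2 = x e.1.1 e.2.1 * x e.1.1 e.2.2 * x e.1.2 e.2.1 * x e.1.2 e.2.2 := by
    intro e he
    obtain ⟨-, h1, h2⟩ := Finset.mem_filter.1 he
    rw [Finset.prod_insert (by simp [h1, h2]), Finset.prod_insert (by simp [h1]),
      Finset.prod_pair (by simp [h2])]
    ring
  rw [Finset.sum_congr rfl h1, Finset.sum_filter, Fintype.sum_prod_type, Fintype.sum_prod_type]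
  set w : m → m → n → n → ℝ := fun i j a b => x i a * x i b * x j a * x j b with hw
  -- Inclusion-exclusion over the coincidences `i = j` and `a = b`.
  have h2 : ∀ i j a b, (if i ≠ j ∧ a ≠ b then x i a * x i b * x j a * x j b else 0)
      = w i j a b - (if i = j then w i j a b else 0) - (if a = b then w i j a b else 0)
        + (if i = j then (if a = b then w i j a b else 0) else 0) := by
    intro i j a b
    by_cases hij : i = j <;> by_cases hab : a = b <;> simp [hij, hab, hw]
  have h3 : ∀ i j, ∑ ab : n × n, (if i ≠ j ∧ ab.1 ≠ ab.2 then
        x i ab.1 * x i ab.2 * x j ab.1 * x j ab.2 else 0)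
      = (∑ t, x i t * x j t) ^ 2 - (if i = j then (∑ t, x i t ^ 2) ^ 2 else 0)
        - ∑ t, x i t ^ 2 * x j t ^ 2 + if i = j then ∑ t, x i t ^ 4 else 0 := by
    intro i j
    rw [Fintype.sum_prod_type]
    simp only [h2, Finset.sum_add_distrib, Finset.sum_sub_distrib]
    congr 1
    · congr 1
      · congr 1
        · rw [sq, Finset.sum_mul_sum]
          refine Finset.sum_congr rfl fun a _ => Finset.sum_congr rfl fun b _ => ?_
          simp only [hw]; ring
        · by_cases hij : i = j
          · subst hij
            simp only [if_true]
            rw [sq, Finset.sum_mul_sum]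
            refine Finset.sum_congr rfl fun a _ => Finset.sum_congr rfl fun b _ => ?_
            simp only [hw]; ring
          · simp [hij]
      · refine Finset.sum_congr rfl fun a _ => ?_
        rw [Finset.sum_ite_eq, if_pos (Finset.mem_univ _)]
        simp only [hw]; ring
    · by_cases hij : i = j
      · subst hij
        simp only [if_true]
        refine Finset.sum_congr rfl fun a _ => ?_
        rw [Finset.sum_ite_eq, if_pos (Finset.mem_univ _)]
        simp only [hw]; ring
      · simp [hij]
  simp only [h3, Finset.sum_add_distrib, Finset.sum_sub_distrib, Finset.sum_ite_eq,
    Finset.mem_univ, if_true]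
  rw [rectForm]
  congr 2
  have h4 : ∀ t, (∑ i, x i t ^ 2) ^ 2 = ∑ i, ∑ j, x i t ^ 2 * x j t ^ 2 := fun t => by
    rw [sq, Finset.sum_mul_sum]
  simp only [h4]
  rw [Finset.sum_comm]
  exact Finset.sum_congr rfl fun i _ => Finset.sum_comm

end Forms

namespace IndepCentered

variable {m n Ω : Type*} [Fintype m] [Fintype n] [DecidableEq m] [DecidableEq n]
  [MeasurableSpace Ω] {P : Measure Ω} {ξ : m × n → Ω → ℝ} {s : ℝ}

lemma memLp_rowForm (h : IndepCentered ξ s P) :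
    MemLp (fun ω => rowForm fun i t => ξ (i, t) ω) 2 P := by
  simp_rw [rowForm_eq_sum]
  exact h.memLp_sum_prod _ fun e : m × n × n => {(e.1, e.2.1), (e.1, e.2.2)}

lemma integral_abs_rowForm_le (h : IndepCentered ξ s P) (hs : 0 ≤ s) :
    ∫ ω, |rowForm fun i t => ξ (i, t) ω| ∂P
      ≤ √(4 * (Fintype.card m * Fintype.card n * Fintype.card n) * s ^ 2) := by
  have := h.indep.isProbabilityMeasure
  refine (integral_abs_le_sqrt h.memLp_rowForm).trans (Real.sqrt_le_sqrt ?_)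
  simp_rw [rowForm_eq_sum]
  refine (h.integral_sq_sum_prod_le _ (fun e : m × n × n => {(e.1, e.2.1), (e.1, e.2.2)}) (d := 2)
    (f := fun e => (e.1, e.2.1)) (g := fun e => (e.1, e.2.2)) ?_ (by simp) (by simp) ?_
    hs).trans ?_
  · intro e he
    rw [Finset.mem_filter] at he
    exact Finset.card_pair (by simpa using he.2)
  · rintro ⟨i, a, b⟩ - ⟨i', a', b'⟩ - h1 h2
    simp only [Prod.mk.injEq] at h1 h2 ⊢
    tauto
  · have hc : ((Finset.univ : Finset (m × n × n)).filter (fun e => e.2.1 ≠ e.2.2)).card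
        ≤ Fintype.card m * (Fintype.card n * Fintype.card n) := by
      refine (Finset.card_filter_le _ _).trans_eq ?_
      rw [Finset.card_univ, Fintype.card_prod, Fintype.card_prod]
    have hc' : (((Finset.univ : Finset (m × n × n)).filter (fun e => e.2.1 ≠ e.2.2)).card : ℝ)
        ≤ Fintype.card m * (Fintype.card n * Fintype.card n) := by exact_mod_cast hc
    refine mul_le_mul_of_nonneg_right ?_ (sq_nonneg s)
    push_cast
    linarith

lemma memLp_rectForm (h : IndepCentered ξ s P) :
    MemLp (fun ω => rectForm fun i t => ξ (i, t) ω) 2 P := by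
  simp_rw [rectForm_eq_sum]
  exact h.memLp_sum_prod _ fun e : (m × m) × n × n =>
    {(e.1.1, e.2.1), (e.1.1, e.2.2), (e.1.2, e.2.1), (e.1.2, e.2.2)}

/-- Two opposite corners determine a rectangle with its labelling, so the monomial count applies
with `d = 4`. -/
lemma integral_abs_rectForm_le (h : IndepCentered ξ s P) (hs : 0 ≤ s) :
    ∫ ω, |rectForm fun i t => ξ (i, t) ω| ∂P
      ≤ √(16 * (Fintype.card m * Fintype.card n) ^ 2 * s ^ 4) := by
  have := h.indep.isProbabilityMeasure
  refine (integral_abs_le_sqrt h.memLp_rectForm).trans (Real.sqrt_le_sqrt ?_)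
  simp_rw [rectForm_eq_sum]
  refine (h.integral_sq_sum_prod_le _ (fun e : (m × m) × n × n =>
    {(e.1.1, e.2.1), (e.1.1, e.2.2), (e.1.2, e.2.1), (e.1.2, e.2.2)}) (d := 4)
    (f := fun e => (e.1.1, e.2.1)) (g := fun e => (e.1.2, e.2.2)) ?_ (by simp) (by simp) ?_
    hs).trans ?_
  · intro e he
    obtain ⟨-, h1, h2⟩ := Finset.mem_filter.1 he
    rw [Finset.card_insert_of_notMem (by simp [h1, h2]),
      Finset.card_insert_of_notMem (by simp [h1]), Finset.card_pair (by simp [h2])]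
  · rintro ⟨⟨i, j⟩, a, b⟩ - ⟨⟨i', j'⟩, a', b'⟩ - h1 h2
    simp only [Prod.mk.injEq] at h1 h2 ⊢
    tauto
  · have hc : ((Finset.univ : Finset ((m × m) × n × n)).filter
        (fun e => e.1.1 ≠ e.1.2 ∧ e.2.1 ≠ e.2.2)).card
        ≤ (Fintype.card m * Fintype.card m) * (Fintype.card n * Fintype.card n) := by
      refine (Finset.card_filter_le _ _).trans_eq ?_
      rw [Finset.card_univ, Fintype.card_prod, Fintype.card_prod, Fintype.card_prod]
    have hc' : (((Finset.univ : Finset ((m × m) × n × n)).filter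
        (fun e => e.1.1 ≠ e.1.2 ∧ e.2.1 ≠ e.2.2)).card : ℝ)
        ≤ (Fintype.card m * Fintype.card m) * (Fintype.card n * Fintype.card n) := by
      exact_mod_cast hc
    refine mul_le_mul_of_nonneg_right ?_ (pow_nonneg hs 4)
    push_cast
    linarith

lemma integral_abs_sum_le (h : IndepCentered ξ s P) (hs : 0 ≤ s) :
    ∫ ω, |∑ k, ξ k ω| ∂P ≤ √(Fintype.card m * Fintype.card n * s) := by
  have := h.indep.isProbabilityMeasure
  refine (integral_abs_le_sqrt (memLp_finsetSum _ fun k _ => h.memLp k)).trans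
    (Real.sqrt_le_sqrt ?_)
  have h1 := h.integral_sq_sum_prod_le Finset.univ (fun k => {k}) (d := 1) (f := id) (g := id)
    (by simp) (by simp) (by simp) (by simp) hs
  simpa using h1

/-- The first absolute moment of the row form of a non-centred array. -/
lemma integral_abs_rowForm_add_const_le (h : IndepCentered ξ s P) (hs : 0 ≤ s) (c : ℝ) :
    Integrable (fun ω => rowForm fun i t => ξ (i, t) ω + c) P ∧
    ∫ ω, |rowForm fun i t => ξ (i, t) ω + c| ∂P
      ≤ √(4 * (Fintype.card m * Fintype.card n * Fintype.card n) * s ^ 2)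
        + 2 * |c| * Fintype.card n * √(Fintype.card m * Fintype.card n * s)
        + c ^ 2 * (Fintype.card m * Fintype.card n * Fintype.card n) := by
  have := h.indep.isProbabilityMeasure
  have hrow : Integrable (fun ω => rowForm fun i t => ξ (i, t) ω) P :=
    h.memLp_rowForm.integrable one_le_two
  have hsum : Integrable (fun ω => ∑ k, ξ k ω) P :=
    integrable_finsetSum _ fun k _ => (h.memLp k).integrable one_le_two
  have he : (fun ω => rowForm fun i t => ξ (i, t) ω + c) = fun ω =>
      (rowForm fun i t => ξ (i, t) ω)
      + 2 * c * ((Fintype.card n : ℝ) - 1) * ∑ k : m × n, ξ k ω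
      + c ^ 2 * (Fintype.card m * (Fintype.card n * ((Fintype.card n : ℝ) - 1))) :=
    funext fun ω => rowForm_add_const (fun i t => ξ (i, t) ω) c
  have hint : Integrable (fun ω => rowForm fun i t => ξ (i, t) ω + c) P := by
    rw [he]
    exact ((hrow.add (hsum.const_mul (2 * c * ((Fintype.card n : ℝ) - 1)))).add
    (integrable_const (c ^ 2 * (Fintype.card m * (Fintype.card n * ((Fintype.card n : ℝ) - 1))))))
  refine ⟨hint, ?_⟩
  -- The estimates below need `card n - 1 ≥ 0`.
  by_cases hn : Fintype.card n = 0
  · have h0 : ∀ ω, (rowForm fun i t => ξ (i, t) ω + c) = 0 := by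
      intro ω
      have : IsEmpty n := Fintype.card_eq_zero_iff.1 hn
      simp [rowForm]
    simp [h0, hn]
  have hn1 : (1 : ℝ) ≤ Fintype.card n := by
    exact_mod_cast Nat.one_le_iff_ne_zero.2 hn
  have hb : ∀ ω, |rowForm fun i t => ξ (i, t) ω + c|
      ≤ |rowForm fun i t => ξ (i, t) ω| + 2 * |c| * Fintype.card n * |∑ k : m × n, ξ k ω|
        + c ^ 2 * (Fintype.card m * Fintype.card n * Fintype.card n) := by
    intro ω
    rw [congrFun he ω]
    refine (abs_add_le _ _).trans (add_le_add ((abs_add_le _ _).trans (add_le_add le_rfl ?_)) ?_)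
    · rw [abs_mul, abs_mul, abs_mul, abs_two, abs_of_nonneg (by linarith : 0 ≤ _ - (1 : ℝ))]
      gcongr
      linarith
    · rw [abs_of_nonneg (mul_nonneg (sq_nonneg c) (mul_nonneg (Nat.cast_nonneg _)
        (mul_nonneg (Nat.cast_nonneg _) (by linarith)))), mul_assoc (Fintype.card m : ℝ)]
      gcongr
      linarith
  have hi1 : Integrable (fun ω => |rowForm fun i t => ξ (i, t) ω|
      + 2 * |c| * Fintype.card n * |∑ k : m × n, ξ k ω|) P :=
    hrow.abs.add (hsum.abs.const_mul (2 * |c| * Fintype.card n))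
  calc ∫ ω, |rowForm fun i t => ξ (i, t) ω + c| ∂P
      ≤ ∫ ω, (|rowForm fun i t => ξ (i, t) ω| + 2 * |c| * Fintype.card n * |∑ k : m × n, ξ k ω|
        + c ^ 2 * (Fintype.card m * Fintype.card n * Fintype.card n)) ∂P :=
        integral_mono hint.abs (hi1.add (integrable_const _)) hb
    _ = ∫ ω, |rowForm fun i t => ξ (i, t) ω| ∂P
        + 2 * |c| * Fintype.card n * ∫ ω, |∑ k : m × n, ξ k ω| ∂P
        + c ^ 2 * (Fintype.card m * Fintype.card n * Fintype.card n) := by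
        rw [integral_add hi1 (integrable_const _),
          integral_add hrow.abs (hsum.abs.const_mul _), integral_const_mul]
        simp
    _ ≤ _ := by
        gcongr
        · exact h.integral_abs_rowForm_le hs
        · exact h.integral_abs_sum_le hs

end IndepCentered

/-! ### Truncation -/

/-- `x² - 1` truncated to `|x| ≤ b`. -/
noncomputable def truncSq (b x : ℝ) : ℝ := {x : ℝ | |x| ≤ b}.indicator (fun x => x ^ 2 - 1) x

lemma truncSq_of_le {b x : ℝ} (h : |x| ≤ b) : truncSq b x = x ^ 2 - 1 :=
  Set.indicator_of_mem (s := {x : ℝ | |x| ≤ b}) h _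

@[fun_prop]
lemma measurable_truncSq (b : ℝ) : Measurable (truncSq b) :=
  Measurable.indicator (by fun_prop) (measurableSet_abs_le b)

lemma abs_truncSq_le (b x : ℝ) : |truncSq b x| ≤ b ^ 2 + 1 := by
  by_cases hx : |x| ≤ b
  · rw [truncSq_of_le hx]
    have h1 : x ^ 2 ≤ b ^ 2 := by
      rw [← sq_abs x]
      exact pow_le_pow_left₀ (abs_nonneg _) hx 2
    rw [abs_le]
    constructor <;> nlinarith [sq_nonneg x, sq_nonneg b]
  · rw [truncSq, Set.indicator_of_notMem (by simpa using hx), abs_zero]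
    positivity

/-- The mean of the truncation of `X² - 1`. -/
noncomputable def truncMean (F : Measure ℝ) (b : ℝ) : ℝ := ∫ x, truncSq b x ∂F

/-- The variance of the truncation of `X² - 1`. -/
noncomputable def truncVar (F : Measure ℝ) (b : ℝ) : ℝ :=
  ∫ x, (truncSq b x - truncMean F b) ^ 2 ∂F

lemma truncVar_nonneg {F : Measure ℝ} (b : ℝ) : 0 ≤ truncVar F b := integral_nonneg fun _ => sq_nonneg _

lemma integrable_sq_of_integral_eq_one {F : Measure ℝ} (h2 : ∫ x, x ^ 2 ∂F = 1) :
    Integrable (fun x : ℝ => x ^ 2) F := by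
  by_contra h
  rw [integral_undef h] at h2
  exact zero_ne_one h2

section Moments

variable {F : Measure ℝ} [IsProbabilityMeasure F]

lemma memLp_truncSq (b : ℝ) : MemLp (truncSq b) 2 F :=
  MemLp.of_bound (by fun_prop) (b ^ 2 + 1) (ae_of_all _ (abs_truncSq_le b))

lemma truncVar_le (b : ℝ) : truncVar F b ≤ ∫ x in {x | |x| ≤ b}, x ^ 4 ∂F + 1 := by
  have h1 : truncVar F b ≤ ∫ x, truncSq b x ^ 2 ∂F := by
    have hv : truncVar F b = variance (truncSq b) F := by
      rw [variance_eq_integral (by fun_prop)]; rfl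
    rw [hv, variance_eq_sub (memLp_truncSq b)]
    simp only [Pi.pow_apply]
    linarith [sq_nonneg (∫ x, truncSq b x ∂F)]
  refine h1.trans ?_
  have hi : Integrable ({x : ℝ | |x| ≤ b}.indicator fun x => x ^ 4) F :=
    (RegularTail.integrableOn_pow_four F b).integrable_indicator (measurableSet_abs_le b)
  calc ∫ x, truncSq b x ^ 2 ∂F
      ≤ ∫ x, ({x : ℝ | |x| ≤ b}.indicator (fun x => x ^ 4) x + 1) ∂F := by
        refine integral_mono (memLp_truncSq b).integrable_sq (hi.add (integrable_const 1))
          fun x => ?_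
        by_cases hx : |x| ≤ b
        · simp only
          rw [truncSq_of_le hx, Set.indicator_of_mem (show x ∈ {x : ℝ | |x| ≤ b} from hx)]
          nlinarith [sq_nonneg x]
        · simp only
          rw [truncSq, Set.indicator_of_notMem (show x ∉ {x : ℝ | |x| ≤ b} from hx),
            Set.indicator_of_notMem (show x ∉ {x : ℝ | |x| ≤ b} from hx)]
          norm_num
    _ = _ := by
        rw [integral_add hi (integrable_const 1), integral_indicator (measurableSet_abs_le b)]
        simp

/-- As `X² - 1` has mean zero, its truncated mean is minus its integral over `|x| > b`, where the
integrand is nonnegative because `b ≥ 1`. -/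
lemma abs_truncMean_le (h2 : ∫ x, x ^ 2 ∂F = 1) {b : ℝ} (hb : 1 ≤ b) :
    |truncMean F b| ≤ ∫ x in {x | b < |x|}, x ^ 2 ∂F := by
  have hi := integrable_sq_of_integral_eq_one h2
  have hi1 : Integrable (fun x : ℝ => x ^ 2 - 1) F := hi.sub (integrable_const 1)
  have h0 : ∫ x, (x ^ 2 - 1) ∂F = 0 := by
    rw [integral_sub hi (integrable_const 1), h2]; simp
  have hc : {x : ℝ | |x| ≤ b}ᶜ = {x | b < |x|} := by
    ext x; simp
  have h1 := integral_add_compl (measurableSet_abs_le b) hi1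
  rw [h0, hc] at h1
  have hm : truncMean F b = -∫ x in {x | b < |x|}, (x ^ 2 - 1) ∂F := by
    rw [truncMean]
    simp only [truncSq]
    rw [integral_indicator (measurableSet_abs_le b)]
    linarith
  have hnn : 0 ≤ ∫ x in {x | b < |x|}, (x ^ 2 - 1) ∂F := by
    refine setIntegral_nonneg (measurableSet_lt_abs b) fun x hx => ?_
    have hx' : 1 ≤ |x| := hb.trans (le_of_lt hx)
    rw [← sq_abs]
    nlinarith
  rw [hm, abs_neg, abs_of_nonneg hnn]
  exact integral_mono hi1.integrableOn hi.integrableOn fun x => by simp only; linarith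

end Moments

/-! ### Truncated moments at the scale of the quantile -/

namespace RegularTail

variable {F : Measure ℝ} [IsProbabilityMeasure F] {α : ℝ}

lemma tendsto_div_tailQuantile_pow_four (h : RegularTail F α) (hα : 2 < α) (hα' : α < 4) :
    Tendsto (fun k : ℕ => (k : ℝ) / tailQuantile F k ^ 4) atTop (𝓝 0) := by
  have h1 := (h.tendsto_pow_four_mul_tail hα hα').comp h.tendsto_tailQuantile
  have h2 := h.tendsto_mul_tail_tailQuantile.mul h1.inv_tendsto_atTop
  rw [mul_zero] at h2
  refine h2.congr fun k => ?_
  have := (h.pos (tailQuantile F k)).ne'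
  simp only [Pi.inv_apply, Function.comp_apply]
  rw [mul_inv]
  field_simp

lemma exists_eventually_truncVar_le (h : RegularTail F α) (hα : 2 < α) (hα' : α < 4) {K : ℝ}
    (hK : 0 < K) :
    ∃ C, 0 ≤ C ∧ ∀ᶠ k : ℕ in atTop,
      k * truncVar F (K * tailQuantile F k) ≤ C * tailQuantile F k ^ 4 := by
  obtain ⟨C, x₀, hC0, hC⟩ := h.exists_integral_pow_four_le hα hα'
  have hKα : 0 < K ^ (-α) := Real.rpow_pos_of_pos hK _
  refine ⟨C * K ^ 4 * (K ^ (-α) + 1) + 1, by positivity, ?_⟩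
  have ha := h.tendsto_tailQuantile
  filter_upwards [(ha.const_mul_atTop hK).eventually_ge_atTop x₀, ha.eventually_gt_atTop 0,
    (h.tendsto_mul_tail_mul_tailQuantile hK).eventually_le_const (lt_add_one _),
    (h.tendsto_div_tailQuantile_pow_four hα hα').eventually_le_const zero_lt_one]
    with k hk ha0 hkT hka
  rw [div_le_iff₀ (by positivity), one_mul] at hka
  have h1 : truncVar F (K * tailQuantile F k) ≤ C * (K * tailQuantile F k) ^ 4
      * tail F (K * tailQuantile F k) + 1 := (truncVar_le _).trans (by gcongr; exact hC _ hk)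
  calc (k : ℝ) * truncVar F (K * tailQuantile F k)
      ≤ k * (C * (K * tailQuantile F k) ^ 4 * tail F (K * tailQuantile F k) + 1) := by gcongr
    _ = C * K ^ 4 * (k * tail F (K * tailQuantile F k)) * tailQuantile F k ^ 4 + k := by ring
    _ ≤ C * K ^ 4 * (K ^ (-α) + 1) * tailQuantile F k ^ 4 + tailQuantile F k ^ 4 := by gcongr
    _ = _ := by ring

lemma exists_eventually_truncMean_le (h : RegularTail F α) (hα : 2 < α) (hα' : α < 4)
    (h2 : ∫ x, x ^ 2 ∂F = 1) {K : ℝ} (hK : 0 < K) :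
    ∃ C, 0 ≤ C ∧ ∀ᶠ k : ℕ in atTop,
      k * |truncMean F (K * tailQuantile F k)| ≤ C * tailQuantile F k ^ 2 := by
  obtain ⟨C, x₀, hC0, hC⟩ := h.exists_integral_sq_le hα hα' (integrable_sq_of_integral_eq_one h2)
  have hKα : 0 < K ^ (-α) := Real.rpow_pos_of_pos hK _
  refine ⟨C * K ^ 2 * (K ^ (-α) + 1), by positivity, ?_⟩
  have ha := h.tendsto_tailQuantile
  filter_upwards [(ha.const_mul_atTop hK).eventually_ge_atTop x₀,
    (ha.const_mul_atTop hK).eventually_ge_atTop 1,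
    (h.tendsto_mul_tail_mul_tailQuantile hK).eventually_le_const (lt_add_one _)]
    with k hk hk1 hkT
  calc (k : ℝ) * |truncMean F (K * tailQuantile F k)|
      ≤ k * (C * (K * tailQuantile F k) ^ 2 * tail F (K * tailQuantile F k)) := by
        gcongr
        exact (abs_truncMean_le h2 hk1).trans (hC _ hk)
    _ = C * K ^ 2 * (k * tail F (K * tailQuantile F k)) * tailQuantile F k ^ 2 := by ring
    _ ≤ C * K ^ 2 * (K ^ (-α) + 1) * tailQuantile F k ^ 2 := by gcongr

end RegularTail

/-! ### The remainder -/

/-- The off-diagonal part of the centred trace, as a function of the data `x` and of `y = x² - 1`. -/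
def offDiagForm {m n : Type*} [Fintype m] [Fintype n] (x y : m → n → ℝ) : ℝ :=
  rowForm y + rowForm (fun t i => y i t) + rectForm x

/-- The bound of `IndepCentered.integral_abs_rowForm_add_const_le`. -/
noncomputable def rowBound (m n s c : ℝ) : ℝ :=
  √(4 * (m * n * n) * s ^ 2) + 2 * |c| * n * √(m * n * s) + c ^ 2 * (m * n * n)

/-- Each term gains a power of `m`: the first is `2 (m n s) / √m`, and in the other two `n |c| ≤ B
a² / m`. -/
lemma rowBound_le {m n s c a A B : ℝ} (hm : 0 < m) (hn : 0 < n) (hs0 : 0 ≤ s) (ha : 0 < a)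
    (hA : 0 ≤ A) (hs : m * n * s ≤ A * a ^ 4) (hc : m * n * |c| ≤ B * a ^ 2) :
    rowBound m n s c ≤ (2 * A / √m + 2 * B * √A / m + B ^ 2 / m) * a ^ 4 := by
  have hsm : 0 < √m := Real.sqrt_pos.2 hm
  have h1 : √(4 * (m * n * n) * s ^ 2) ≤ 2 * A / √m * a ^ 4 := by
    refine Real.sqrt_le_iff.2 ⟨by positivity, ?_⟩
    have h3 : (m * n * s) ^ 2 ≤ (A * a ^ 4) ^ 2 := pow_le_pow_left₀ (by positivity) hs 2
    rw [mul_pow, div_pow, Real.sq_sqrt hm.le, div_mul_eq_mul_div, le_div_iff₀ hm]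
    nlinarith
  have h2 : √(m * n * s) ≤ √A * a ^ 2 := by
    refine Real.sqrt_le_iff.2 ⟨by positivity, ?_⟩
    rw [mul_pow, Real.sq_sqrt hA]
    nlinarith
  have h3 : |c| * n ≤ B * a ^ 2 / m := by
    rw [le_div_iff₀ hm]; linarith
  have h4 : 2 * |c| * n * √(m * n * s) ≤ 2 * B * √A / m * a ^ 4 := by
    calc 2 * |c| * n * √(m * n * s) = 2 * (|c| * n) * √(m * n * s) := by ring
      _ ≤ 2 * (B * a ^ 2 / m) * (√A * a ^ 2) := by
        have : 0 ≤ B * a ^ 2 / m := le_trans (by positivity) h3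
        gcongr
      _ = _ := by ring
  have h5 : c ^ 2 * (m * n * n) ≤ B ^ 2 / m * a ^ 4 := by
    have h6 : (|c| * n) ^ 2 ≤ (B * a ^ 2 / m) ^ 2 := pow_le_pow_left₀ (by positivity) h3 2
    calc c ^ 2 * (m * n * n) = m * (|c| * n) ^ 2 := by rw [mul_pow, sq_abs]; ring
      _ ≤ m * (B * a ^ 2 / m) ^ 2 := by gcongr
      _ = _ := by field_simp
  rw [rowBound]
  linarith

section Array

variable {m n Ω : Type*} [MeasurableSpace Ω] {P : Measure Ω} {F : Measure ℝ} {X : m × n → Ω → ℝ}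

lemma IndepCentered.swap {ξ : m × n → Ω → ℝ} {s : ℝ} (h : IndepCentered ξ s P) :
    IndepCentered (fun k : n × m => ξ k.swap) s P where
  indep := h.indep.precomp Prod.swap_injective
  memLp _ := h.memLp _
  mean _ := h.mean _
  var _ := h.var _

lemma indepCentered_of_hasLaw (hX : ∀ k, HasLaw (X k) F P) (hind : iIndepFun X P) {g : ℝ → ℝ}
    (hg : Measurable g) (hg2 : MemLp g 2 F) (hg0 : ∫ x, g x ∂F = 0) :
    IndepCentered (fun k ω => g (X k ω)) (∫ x, g x ^ 2 ∂F) P where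
  indep := hind.comp (fun _ => g) fun _ => hg
  memLp k := by
    have h := hg2
    rw [← (hX k).map_eq] at h
    exact h.comp_of_map (hX k).aemeasurable
  mean k := by
    rw [← hg0]
    exact (hX k).integral_comp hg.aestronglyMeasurable
  var k := (hX k).integral_comp (f := fun x => g x ^ 2) (by fun_prop)

lemma indepCentered_truncSq [IsProbabilityMeasure F] (hX : ∀ k, HasLaw (X k) F P) (hind : iIndepFun X P) (b : ℝ) :
    IndepCentered (fun k ω => truncSq b (X k ω) - truncMean F b) (truncVar F b) P :=
  indepCentered_of_hasLaw hX hind (g := fun x => truncSq b x - truncMean F b) (by fun_prop)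
    ((memLp_truncSq b).sub (memLp_const _)) (by
      rw [integral_sub ((memLp_truncSq b).integrable one_le_two) (integrable_const _)]
      simp [truncMean])

lemma indepCentered_self (hX : ∀ k, HasLaw (X k) F P) (hind : iIndepFun X P)
    (h1 : ∫ x, x ∂F = 0) (h2 : ∫ x, x ^ 2 ∂F = 1) : IndepCentered X 1 P := by
  have := indepCentered_of_hasLaw hX hind (g := fun x => x) measurable_id
    ((memLp_two_iff_integrable_sq (by fun_prop)).2 (integrable_sq_of_integral_eq_one h2)) h1
  rwa [h2] at this

variable [Fintype m] [Fintype n]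

lemma measureReal_exists_lt_abs_le (hX : ∀ k, HasLaw (X k) F P) (b : ℝ) :
    P.real {ω | ∃ k, b < |X k ω|} ≤ Fintype.card m * Fintype.card n * tail F b := by
  have h1 : {ω | ∃ k, b < |X k ω|} = ⋃ k, {ω | b < |X k ω|} := by
    ext ω; simp
  rw [h1]
  refine (measureReal_iUnion_fintype_le _).trans_eq ?_
  have h2 : ∀ k, P.real {ω | b < |X k ω|} = tail F b := fun k =>
    (hX k).measureReal_eq (p := fun x => b < |x|) (measurableSet_lt_abs b)
  simp [h2]

variable [IsProbabilityMeasure F]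

lemma integral_abs_offDiagForm_le [DecidableEq m] [DecidableEq n] (hX : ∀ k, HasLaw (X k) F P)
    (hind : iIndepFun X P)
    (h1 : ∫ x, x ∂F = 0) (h2 : ∫ x, x ^ 2 ∂F = 1) (b : ℝ) :
    Integrable (fun ω => offDiagForm (fun i t => X (i, t) ω)
      (fun i t => truncSq b (X (i, t) ω))) P ∧
    ∫ ω, |offDiagForm (fun i t => X (i, t) ω) (fun i t => truncSq b (X (i, t) ω))| ∂P
      ≤ rowBound (Fintype.card m) (Fintype.card n) (truncVar F b) (truncMean F b)
        + rowBound (Fintype.card n) (Fintype.card m) (truncVar F b) (truncMean F b)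
        + 4 * (Fintype.card m * Fintype.card n) := by
  have := hind.isProbabilityMeasure
  have hξ := indepCentered_truncSq hX hind b
  have hx := indepCentered_self hX hind h1 h2
  obtain ⟨hi1, hb1⟩ := hξ.integral_abs_rowForm_add_const_le (truncVar_nonneg b) (truncMean F b)
  obtain ⟨hi2, hb2⟩ :=
    hξ.swap.integral_abs_rowForm_add_const_le (truncVar_nonneg b) (truncMean F b)
  simp only [sub_add_cancel, Prod.swap_prod_mk] at hi1 hi2 hb1 hb2
  have hi3 : Integrable (fun ω => rectForm fun i t => X (i, t) ω) P :=
    hx.memLp_rectForm.integrable one_le_two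
  have hb3 : ∫ ω, |rectForm fun i t => X (i, t) ω| ∂P ≤ 4 * (Fintype.card m * Fintype.card n) := by
    refine (hx.integral_abs_rectForm_le zero_le_one).trans (Real.sqrt_le_iff.2 ⟨by positivity, ?_⟩)
    linarith
  refine ⟨(hi1.add hi2).add hi3, ?_⟩
  have hi12 : Integrable (fun ω => |rowForm fun i t => truncSq b (X (i, t) ω)|
      + |rowForm fun t i => truncSq b (X (i, t) ω)|) P := hi1.abs.add hi2.abs
  calc ∫ ω, |offDiagForm (fun i t => X (i, t) ω) (fun i t => truncSq b (X (i, t) ω))| ∂P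
      ≤ ∫ ω, (|rowForm fun i t => truncSq b (X (i, t) ω)|
          + |rowForm fun t i => truncSq b (X (i, t) ω)| + |rectForm fun i t => X (i, t) ω|) ∂P :=
        integral_mono ((hi1.add hi2).add hi3).abs (hi12.add hi3.abs) fun ω =>
          (abs_add_le _ _).trans (add_le_add_left (abs_add_le _ _) _)
    _ = ∫ ω, |rowForm fun i t => truncSq b (X (i, t) ω)| ∂P
          + ∫ ω, |rowForm fun t i => truncSq b (X (i, t) ω)| ∂P
          + ∫ ω, |rectForm fun i t => X (i, t) ω| ∂P := by
        rw [integral_add hi12 hi3.abs, integral_add hi1.abs hi2.abs]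
    _ ≤ _ := add_le_add (add_le_add hb1 hb2) hb3

lemma aemeasurable_rowForm {y : m → n → Ω → ℝ} (hy : ∀ i t, AEMeasurable (y i t) P) :
    AEMeasurable (fun ω => rowForm fun i t => y i t ω) P := by
  unfold rowForm
  fun_prop

lemma aemeasurable_rectForm {x : m → n → Ω → ℝ} (hx : ∀ i t, AEMeasurable (x i t) P) :
    AEMeasurable (fun ω => rectForm fun i t => x i t ω) P := by
  unfold rectForm
  fun_prop

lemma aemeasurable_offDiagForm {x y : m → n → Ω → ℝ} (hx : ∀ i t, AEMeasurable (x i t) P)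
    (hy : ∀ i t, AEMeasurable (y i t) P) :
    AEMeasurable (fun ω => offDiagForm (fun i t => x i t ω) fun i t => y i t ω) P :=
  ((aemeasurable_rowForm hy).add (aemeasurable_rowForm fun t i => hy i t)).add
    (aemeasurable_rectForm hx)

/-- Comparison of the characteristic functions of the centred trace and of its diagonal part. -/
lemma norm_charFun_sub_charFun_le [DecidableEq m] [DecidableEq n] (hX : ∀ k, HasLaw (X k) F P)
    (hind : iIndepFun X P)
    (h1 : ∫ x, x ∂F = 0) (h2 : ∫ x, x ^ 2 ∂F = 1) (b : ℝ) {a : ℝ} (ha : 0 < a) (t : ℝ) :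
    ‖charFun (P.map fun ω => ∑ k, X k ω ^ 4 / a ^ 4 + offDiagForm (fun i t => X (i, t) ω)
        (fun i t => X (i, t) ω ^ 2 - 1) / a ^ 4) t
      - charFun (P.map fun ω => ∑ k, X k ω ^ 4 / a ^ 4) t‖
    ≤ |t| * ((rowBound (Fintype.card m) (Fintype.card n) (truncVar F b) (truncMean F b)
        + rowBound (Fintype.card n) (Fintype.card m) (truncVar F b) (truncMean F b)
        + 4 * (Fintype.card m * Fintype.card n)) / a ^ 4)
      + 2 * (Fintype.card m * Fintype.card n * tail F b) := by
  have := hind.isProbabilityMeasure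
  have hXm : ∀ k, AEMeasurable (X k) P := fun k => (hX k).aemeasurable
  have hMm : AEMeasurable (fun ω => ∑ k, X k ω ^ 4 / a ^ 4) P := by fun_prop
  set R : Ω → ℝ := fun ω => offDiagForm (fun i t => X (i, t) ω) (fun i t => X (i, t) ω ^ 2 - 1)
    with hR
  set R' : Ω → ℝ := fun ω => offDiagForm (fun i t => X (i, t) ω) (fun i t => truncSq b (X (i, t) ω))
    with hR'
  have hRm : AEMeasurable R P := aemeasurable_offDiagForm (x := fun i t => X (i, t))
    (y := fun i t ω => X (i, t) ω ^ 2 - 1) (fun i t => hXm _)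
    (fun i t => ((hXm _).pow_const 2).sub_const 1)
  obtain ⟨hiR, hbR⟩ := integral_abs_offDiagForm_le hX hind h1 h2 b
  set M : Ω → ℝ := fun ω => ∑ k, X k ω ^ 4 / a ^ 4 with hM
  have hTm : AEMeasurable (fun ω => M ω + R ω / a ^ 4) P := hMm.add (hRm.div_const _)
  have hbdd : ∀ {Z : Ω → ℝ}, AEMeasurable Z P →
      Integrable (fun ω => Complex.exp (Complex.I * t * Z ω)) P := fun hZ =>
    Integrable.of_bound (AEMeasurable.aestronglyMeasurable (by fun_prop)) 1
      (ae_of_all _ fun ω => (norm_exp_I_mul t _).le)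
  have hcf : ∀ {Z : Ω → ℝ}, AEMeasurable Z P →
      charFun (P.map Z) t = ∫ ω, Complex.exp (Complex.I * t * Z ω) ∂P := by
    intro Z hZ
    rw [charFun_apply_real, integral_map hZ (by fun_prop)]
    congr 1
    ext ω
    ring_nf
  rw [hcf hTm, hcf hMm, ← integral_sub (hbdd hTm) (hbdd hMm)]
  -- A measurable hull is taken because the `X k` are only almost everywhere measurable. Off it
  -- truncation changes nothing; on it the integrand is bounded by `2`.
  set bad : Set Ω := toMeasurable P {ω | ∃ k, b < |X k ω|} with hbad
  have hbadm : MeasurableSet bad := measurableSet_toMeasurable _ _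
  have hpt : ∀ ω, ‖Complex.exp (Complex.I * t * (M ω + R ω / a ^ 4 : ℝ))
      - Complex.exp (Complex.I * t * M ω)‖
      ≤ |t| * (|R' ω| / a ^ 4) + bad.indicator (fun _ => (2 : ℝ)) ω := by
    intro ω
    have he : Complex.exp (Complex.I * t * (M ω + R ω / a ^ 4 : ℝ))
        - Complex.exp (Complex.I * t * M ω) = Complex.exp (Complex.I * t * M ω)
          * (Complex.exp (Complex.I * t * (R ω / a ^ 4 : ℝ)) - 1) := by
      rw [mul_sub, mul_one, ← Complex.exp_add]
      push_cast
      ring_nf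
    rw [he, norm_mul, norm_exp_I_mul, one_mul]
    by_cases hω : ω ∈ bad
    · rw [Set.indicator_of_mem hω]
      have := norm_exp_I_mul_sub_one_le_two t (R ω / a ^ 4)
      have : 0 ≤ |t| * (|R' ω| / a ^ 4) := by positivity
      linarith
    · have hgood : ∀ k, |X k ω| ≤ b := by
        by_contra! hc
        exact hω (subset_toMeasurable _ _ hc)
      have hRR : R ω = R' ω := by
        simp only [hR, hR']
        congr 1
        ext i s
        rw [truncSq_of_le (hgood _)]
      rw [Set.indicator_of_notMem hω, add_zero, hRR]
      refine (norm_exp_I_mul_sub_one_le t _).trans_eq ?_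
      rw [abs_div, abs_of_pos (pow_pos ha 4)]
  have hi1 : Integrable (fun ω => |t| * (|R' ω| / a ^ 4)) P := (hiR.abs.div_const _).const_mul _
  have hi2 : Integrable (bad.indicator fun _ => (2 : ℝ)) P := (integrable_const _).indicator hbadm
  refine (norm_integral_le_of_norm_le (hi1.add hi2) (ae_of_all _ hpt)).trans ?_
  have hsplit : ∫ ω, ((fun ω => |t| * (|R' ω| / a ^ 4)) + bad.indicator fun _ => (2 : ℝ)) ω ∂P
      = |t| * ((∫ ω, |R' ω| ∂P) / a ^ 4) + 2 * P.real {ω | ∃ k, b < |X k ω|} := by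
    rw [integral_add' hi1 hi2, integral_const_mul, integral_div, integral_indicator hbadm]
    simp [hbad, Measure.real, mul_comm]
  rw [hsplit]
  have := measureReal_exists_lt_abs_le hX b
  gcongr

lemma charFun_map_sum_pow_four (hX : ∀ k, HasLaw (X k) F P) (hind : iIndepFun X P) (a t : ℝ) :
    charFun (P.map fun ω => ∑ k, X k ω ^ 4 / a ^ 4) t
      = (1 + ∫ x : ℝ, (Complex.exp (Complex.I * t * ((x ^ 4 / a ^ 4 : ℝ) : ℂ)) - 1) ∂F)
        ^ (Fintype.card n * Fintype.card m) := by
  have hg : Measurable fun x : ℝ => x ^ 4 / a ^ 4 := by fun_prop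
  have hind' : iIndepFun (fun k ω => X k ω ^ 4 / a ^ 4) P :=
    hind.comp (fun _ x => x ^ 4 / a ^ 4) fun _ => hg
  have hm : ∀ k, AEMeasurable (fun ω => X k ω ^ 4 / a ^ 4) P := fun k =>
    hg.comp_aemeasurable (hX k).aemeasurable
  rw [hind'.charFun_map_fun_sum_eq_prod hm]
  have hi : Integrable (fun x : ℝ => Complex.exp (Complex.I * t * ((x ^ 4 / a ^ 4 : ℝ) : ℂ))) F :=
    Integrable.of_bound (by fun_prop) 1 (ae_of_all _ fun x => (norm_exp_I_mul t _).le)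
  have h1 : ∀ k, charFun (P.map fun ω => X k ω ^ 4 / a ^ 4) t
      = 1 + ∫ x : ℝ, (Complex.exp (Complex.I * t * ((x ^ 4 / a ^ 4 : ℝ) : ℂ)) - 1) ∂F := by
    intro k
    rw [charFun_apply_real, integral_map (hm k) (by fun_prop), integral_sub hi (integrable_const _)]
    have := (hX k).integral_comp (f := fun x : ℝ =>
      Complex.exp (Complex.I * t * ((x ^ 4 / a ^ 4 : ℝ) : ℂ))) (by fun_prop)
    rw [← this]
    simp only [integral_const, probReal_univ, one_smul, add_sub_cancel, Function.comp_def]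
    congr 1
    ext ω
    ring_nf
  simp [h1, Finset.prod_const, mul_comm]

end Array

/-! ### The expansion of the centred trace -/

lemma sampleCov_apply {p n : ℕ} (x : Fin p → Fin n → ℝ) (i j : Fin p) :
    sampleCov x i j = (n : ℝ)⁻¹ * ∑ t, x i t * x j t := by
  simp [sampleCov, Matrix.sum_apply, Matrix.vecMulVec_apply]

lemma trace_sampleCov {p n : ℕ} (x : Fin p → Fin n → ℝ) :
    (sampleCov x).trace = (n : ℝ)⁻¹ * ∑ i, ∑ t, x i t ^ 2 := by
  simp only [Matrix.trace, Matrix.diag_apply, sampleCov_apply, ← Finset.mul_sum, sq]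

lemma trace_sampleCov_sq {p n : ℕ} (x : Fin p → Fin n → ℝ) :
    (sampleCov x ^ 2).trace = ((n : ℝ)⁻¹) ^ 2 * ∑ i, ∑ j, (∑ t, x i t * x j t) ^ 2 := by
  simp only [Matrix.trace, Matrix.diag_apply, sq (sampleCov x), Matrix.mul_apply, sampleCov_apply,
    Finset.mul_sum]
  refine Finset.sum_congr rfl fun i _ => Finset.sum_congr rfl fun j _ => ?_
  have : ∀ t, x j t * x i t = x i t * x j t := fun t => mul_comm _ _
  simp only [this, ← Finset.mul_sum]
  ring

lemma rowForm_sq_sub_one {m n : Type*} [Fintype m] [Fintype n] (x : m → n → ℝ) :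
    rowForm (fun i t => x i t ^ 2 - 1) = ∑ i, (∑ t, x i t ^ 2) ^ 2 - ∑ i, ∑ t, x i t ^ 4
      - 2 * ((Fintype.card n : ℝ) - 1) * ∑ i, ∑ t, x i t ^ 2
      + Fintype.card m * (Fintype.card n * ((Fintype.card n : ℝ) - 1)) := by
  have h := rowForm_add_const (fun i t => x i t ^ 2) (-1)
  simp only [← sub_eq_add_neg] at h
  have h4 : ∀ i t, (x i t ^ 2) ^ 2 = x i t ^ 4 := fun i t => by ring
  rw [h, rowForm, Finset.sum_sub_distrib, Fintype.sum_prod_type]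
  simp only [h4]
  ring

/-- The row and column forms of `x² - 1` have linear coefficients `2 (n - 1)` and `2 (p - 1)` and
constants `np (n - 1)` and `np (p - 1)`; these add up to the given centring. -/
lemma centeredTrace_eq (F : Measure ℝ) {p n : ℕ} (x : Fin p → Fin n → ℝ) :
    centeredTrace F x = ∑ k : Fin p × Fin n, x k.1 k.2 ^ 4 / tailQuantile F (n * p) ^ 4
      + offDiagForm x (fun i t => x i t ^ 2 - 1) / tailQuantile F (n * p) ^ 4 := by
  have hcol := rowForm_sq_sub_one fun t i => x i t
  -- For `n = 0` the factor `n⁻¹` does not cancel, but every sum is empty.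
  rcases Nat.eq_zero_or_pos n with rfl | hn
  · simp [centeredTrace, offDiagForm, rowForm, rectForm, trace_sampleCov, trace_sampleCov_sq]
  have hn0 : (n : ℝ) ≠ 0 := by positivity
  rw [centeredTrace, trace_sampleCov, trace_sampleCov_sq, offDiagForm, rowForm_sq_sub_one x, hcol,
    rectForm, ← Finset.sum_div, Fintype.sum_prod_type,
    Finset.sum_comm (f := fun t i => x i t ^ 4), Finset.sum_comm (f := fun t i => x i t ^ 2)]
  simp only [Fintype.card_fin]
  have h1 : ∀ A : ℝ, (n : ℝ) ^ 2 / tailQuantile F (n * p) ^ 4 * ((n : ℝ)⁻¹ ^ 2 * A)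
      = A / tailQuantile F (n * p) ^ 4 := fun A => by field_simp
  have h2 : ∀ A : ℝ, 2 * (n : ℝ) * ((n : ℝ) + (p : ℝ) - 2) / tailQuantile F (n * p) ^ 4 *
      ((n : ℝ)⁻¹ * A) = 2 * ((n : ℝ) + (p : ℝ) - 2) * A / tailQuantile F (n * p) ^ 4 :=
    fun A => by field_simp
  rw [h1, h2]
  ring

lemma aemeasurable_centeredTrace (F : Measure ℝ) {p n : ℕ} {Ω : Type*} [MeasurableSpace Ω] {P : Measure Ω}
    {X : Fin p → Fin n → Ω → ℝ} (hX : ∀ i t, AEMeasurable (X i t) P) :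
    AEMeasurable (fun ω => centeredTrace F fun i t => X i t ω) P := by
  simp_rw [centeredTrace_eq]
  have h1 := aemeasurable_offDiagForm hX fun i t => ((hX i t).pow_const 2).sub_const 1
  have h2 : ∀ k : Fin p × Fin n, AEMeasurable (fun ω => X k.1 k.2 ω) P := fun k => hX _ _
  exact AEMeasurable.add (by fun_prop) (h1.div_const _)

/-! ### Convergence of the characteristic functions -/

section Limit

variable {F : Measure ℝ} [IsProbabilityMeasure F] {α : ℝ}

/-- Only the first dimension has to diverge. Applied to `(p, n)` and to `(n, p)`, this is where both
`p → ∞` and `n → ∞` are needed. -/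
lemma tendsto_rowBound_div {N : ℕ → ℕ} (hN : Tendsto N atTop atTop) {m n : ℕ → ℕ}
    (hm : Tendsto m atTop atTop) (hn : ∀ᶠ l in atTop, 0 < n l) (hmn : ∀ l, m l * n l = N l)
    (h : RegularTail F α) (hα : 2 < α) (hα' : α < 4) (h2 : ∫ x, x ^ 2 ∂F = 1) {K : ℝ}
    (hK : 0 < K) :
    Tendsto (fun l => rowBound (m l) (n l) (truncVar F (K * tailQuantile F (N l)))
      (truncMean F (K * tailQuantile F (N l))) / tailQuantile F (N l) ^ 4) atTop (𝓝 0) := by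
  obtain ⟨A, hA, hA'⟩ := h.exists_eventually_truncVar_le hα hα' hK
  obtain ⟨B, hB, hB'⟩ := h.exists_eventually_truncMean_le hα hα' h2 hK
  have hmR : Tendsto (fun l => (m l : ℝ)) atTop atTop := tendsto_natCast_atTop_atTop.comp hm
  have hlim : Tendsto (fun l => 2 * A / √(m l : ℝ) + 2 * B * √A / (m l : ℝ) + B ^ 2 / (m l : ℝ))
      atTop (𝓝 0) := by
    have h3 := ((Real.tendsto_sqrt_atTop.comp hmR).const_div_atTop (2 * A)).add
      (hmR.const_div_atTop (2 * B * √A))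
    simpa using h3.add (hmR.const_div_atTop (B ^ 2))
  refine squeeze_zero' ?_ ?_ hlim
  · refine Eventually.of_forall fun l => ?_
    have : 0 ≤ rowBound (m l) (n l) (truncVar F (K * tailQuantile F (N l)))
      (truncMean F (K * tailQuantile F (N l))) := by unfold rowBound; positivity
    positivity
  · filter_upwards [hN.eventually hA', hN.eventually hB', hm.eventually_gt_atTop 0, hn,
      (h.tendsto_tailQuantile.comp hN).eventually_gt_atTop 0] with l h3 h4 hml hnl ha
    have ha' : 0 < tailQuantile F (N l) := ha
    rw [div_le_iff₀ (by positivity)]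
    have hcast : (N l : ℝ) = m l * n l := by rw [← hmn l]; push_cast; ring
    rw [hcast] at h3 h4
    exact rowBound_le (by exact_mod_cast hml) (by exact_mod_cast hnl) (truncVar_nonneg _) ha' hA h3
      h4

lemma tendsto_charFun_centeredTrace (h : RegularTail F α) (hα : 2 < α) (hα' : α < 4)
    (h1 : ∫ x, x ∂F = 0) (h2 : ∫ x, x ^ 2 ∂F = 1) {p : ℕ → ℕ} (hp : Tendsto p atTop atTop)
    {Ω : ℕ → Type*} [∀ n, MeasurableSpace (Ω n)] {P : ∀ n, Measure (Ω n)}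
    {X : ∀ n, Fin (p n) × Fin n → Ω n → ℝ} (hX : ∀ n k, HasLaw (X n k) F (P n))
    (hind : ∀ n, iIndepFun (X n) (P n)) (t : ℝ) :
    Tendsto (fun n => charFun ((P n).map fun ω => centeredTrace F fun i t => X n (i, t) ω) t) atTop
      (𝓝 (Complex.exp ((α / 4 : ℝ) * stableExponent (α / 4) t))) := by
  let N : ℕ → ℕ := fun n => n * p n
  have hN : Tendsto N atTop atTop := tendsto_id.atTop_mul_atTop₀ hp
  have ha := h.tendsto_tailQuantile.comp hN
  refine tendsto_of_forall_approx fun η hη => ?_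
  have hlimK : Tendsto (fun K : ℝ => 2 * K ^ (-α)) atTop (𝓝 0) := by
    simpa using (tendsto_rpow_neg_atTop (by linarith : 0 < α)).const_mul 2
  -- The level `K` is fixed before `n → ∞`; the entries beyond `K a` then cost at most `2 K^{-α} <
  -- η` in the limit.
  obtain ⟨K, hKη, hK⟩ :=
    ((hlimK.eventually_lt_const hη).and (eventually_gt_atTop (0 : ℝ))).exists
  refine ⟨fun n => charFun ((P n).map fun ω => ∑ k, X n k ω ^ 4 / tailQuantile F (N n) ^ 4) t, _,
    ?_, ?_, by rw [sub_self, norm_zero]; exact hη.le⟩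
  · have h3 := (Complex.tendsto_one_add_pow_exp_of_tendsto
      (h.tendsto_mul_integral_exp_sub_one hα hα' t)).comp hN
    refine h3.congr fun n => ?_
    rw [charFun_map_sum_pow_four (hX n) (hind n)]
    simp [N]
  · have hr1 := tendsto_rowBound_div hN hp (n := fun l => l) (eventually_gt_atTop 0)
      (fun l => mul_comm _ _) h hα hα' h2 hK
    have hr2 := tendsto_rowBound_div hN (m := fun l => l) tendsto_id (hp.eventually_gt_atTop 0)
      (fun l => rfl) h hα hα' h2 hK
    have hr3 := ((h.tendsto_div_tailQuantile_pow_four hα hα').comp hN).const_mul 4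
    have hbad := ((h.tendsto_mul_tail_mul_tailQuantile hK).comp hN).const_mul 2
    have hall := (((hr1.add hr2).add hr3).const_mul |t|).add hbad
    rw [mul_zero, add_zero, add_zero, mul_zero, zero_add] at hall
    filter_upwards [hall.eventually_le_const hKη, ha.eventually_gt_atTop 0] with n hn han
    have han' : 0 < tailQuantile F (N n) := han
    have h3 := norm_charFun_sub_charFun_le (hX n) (hind n) h1 h2 (K * tailQuantile F (N n)) han' t
    simp_rw [centeredTrace_eq]
    refine h3.trans (le_trans (le_of_eq ?_) hn)
    have hcast : (N n : ℝ) = p n * n := by simp only [N]; push_cast; ring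
    simp only [Fintype.card_fin, Function.comp_apply, hcast]
    ring

end Limit

/-! ### The limit theorem -/

theorem theorem2p3 (α : ℝ) (hα : 2 < α) (hα' : α < 4) :
    -- the constant and the limit law depend on `α` only
    ∃ (c : ℝ) (ζ : ProbabilityMeasure ℝ),
      (∀ z : ℝ, (ζ : Measure ℝ) ≠ Measure.dirac z) ∧
      StableLaw (ζ : Measure ℝ) (α / 4) ∧
      (∀ t : ℝ, IntegrableOn (stableIntegrand (α / 4) t) (Set.Ioi 0) volume ∧
        charFun (ζ : Measure ℝ) t
          = Complex.exp (Complex.I * t * c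
              + (α / 4) * ∫ x in Set.Ioi (0 : ℝ), stableIntegrand (α / 4) t x)) ∧
      -- `F` is the law of the generic entry
      ∀ (F : Measure ℝ) [IsProbabilityMeasure F],
        ∫ x, x ∂F = 0 → ∫ x, x ^ 2 ∂F = 1 → RegularlyVaryingLaw F α →
        ∀ (p : ℕ → ℕ), Tendsto p atTop atTop →
        -- for each sample size `n`, a `p n × n` array of i.i.d. entries with law `F`
        ∀ (Ω : ℕ → Type*) [∀ n, MeasurableSpace (Ω n)]
          (P : ∀ n, Measure (Ω n)) [∀ n, IsProbabilityMeasure (P n)]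
          (X : ∀ n, Fin (p n) → Fin n → Ω n → ℝ),
          (∀ n i t, HasLaw (X n i t) F (P n)) →
          (∀ n, iIndepFun (fun k : Fin (p n) × Fin n => X n k.1 k.2) (P n)) →
          TendstoInDistribution
            (fun n ω => centeredTrace F (fun i t => X n i t ω)) atTop
            (fun z : ℝ => z) P (ζ : Measure ℝ) := by
  have hβ : 0 < α / 4 := by linarith
  have hβ' : α / 4 < 1 := by linarith
  obtain ⟨ζ, hζ⟩ := exists_charFun_eq_exp_stableExponent hβ hβ'
  -- The constant `c` cancels the compensator `itx / (1 + x²)`, which is integrable by itself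
  -- against the Lévy measure since `α / 4 < 1`.
  refine ⟨α / 4 * stableDrift (α / 4), ζ, ne_dirac_of_charFun_eq hβ hβ' hζ,
    stableLaw_of_charFun_eq hβ hζ, fun t => ⟨integrableOn_stableIntegrand hβ hβ' t, ?_⟩, ?_⟩
  · rw [hζ, integral_stableIntegrand hβ hβ']
    push_cast
    ring_nf
  · intro F _ h1 h2 hF p hp Ω _ P _ X hX hind
    refine ⟨fun n => aemeasurable_centeredTrace F fun i t => (hX n i t).aemeasurable,
      aemeasurable_id, ProbabilityMeasure.tendsto_of_tendsto_charFun fun t => ?_⟩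
    have h3 := tendsto_charFun_centeredTrace hF.regularTail hα hα' h1 h2 hp
      (X := fun n k => X n k.1 k.2) (fun n k => hX n k.1 k.2) hind t
    simpa [hζ] using h3
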